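/- Let $k$ be a field of characteristic $0$ with a nonarchimedean absolute value $|\cdot|$ (for instance a complete discrete valuation field of mixed characteristic), and let $0<\gamma<1$. Let $A_{\gamma,x}=A_\gamma[x^{-1}]\subset k((x))$, where $A_\gamma$ is the ring of power series $\sum_{i\ge 0} a_ix^i$ over $k$ with $|a_i|\gamma^i\to 0$. For $0<\rho\le\gamma$ let $|\sum_i a_ix^i|_\rho=\sup_i|a_i|\rho^i$ be the $\rho$-Gauss norm on $A_{\gamma,x}$ and $v_\rho=-\log|\cdot|_\rho$. Let $\ell=\sum_{i=0}^n a_iT^i$ be a monic twisted polynomial of degree $n\ge 1$ with coefficients $a_i\in A_{\gamma,x}$, where $Ta=aT+\frac{da}{dx}$. The Newton polygon $\mathrm{NP}_\rho(\ell)$ is the lower boundary of the convex hull of the points $(-i,v_\rho(a_i))$, $0\le i\le n$ (points with $a_i=0$ lie at infinity). Its breaks are $-n$, $0$ and all integers $-n<m<0$ such that its slope on $[m-1,m]$ is strictly smaller than its slope on $[m,m+1]$. A slope of $\mathrm{NP}_\rho(\ell)$ is effective if it is $<\log\rho$. For $a_i\ne 0$ write $a_i=b_ix^{\mathrm{ord}_x(a_i)}+(\text{terms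 of higher degree})$ with $b_i\in k^\times$. The formal slopes of a differential module of rank $n$ over $(k((x)),\frac{d}{dx})$ are the $n$ rational numbers obtained as follows: over $\overline{k}((x^{1/N}))$ for a suitable $N\ge 1$ the module is a successive extension of modules of rank one (Turrittin--Levelt), and a module of rank one with generator $e$, $De=fe$, contributes the slope $\max\{0,-1-\mathrm{ord}_x(f)\}$. Let $\beta_1\ge\cdots\ge\beta_n$ be the formal slopes of $k((x))\{T\}/k((x))\{T\}\ell$. There exists a real number $c$ with $0<c\le\gamma$ such that for all $\rho\in(0,c]$ the following conditions hold, where all indices run only over those $i$ with $a_i\neq 0$: (i) $|a_i|_\rho=|b_i|\rho^{\mathrm{ord}_x(a_i)}$ for $0\le i\le n$; (ii) $\left|\dfrac{\log\left(\left|b_j/b_h\right|^{1/(j-h)}\cdot\left|b_h/b_l\right|^{1/(l-h)}\right)}{-\log\rho}\right|<\dfrac1{n^2+1}$ for $0\le h<j\le l\le n$; (iii) $\left|\dfrac{\log\left|b_l/b_j\right|^{1/(l-j)}}{-\log\rho}\right|<\dfrac1{n+1}$ for $0\le j<l\le n$. For every such $c$ the following hold. (1) For every $\rho\in(0,c]$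 the polygons $\mathrm{NP}_\rho(\ell)$ and $\mathrm{NP}_c(\ell)$ have the same breaks. (2) Let $-n=m_0<m_1<\cdots<m_r=0$ be the breaks of $\mathrm{NP}_c(\ell)$, and let $t$ be such that the slope of $\mathrm{NP}_c(\ell)$ on $[m_t,m_{t+1}]$ is effective. Then for every $s\in\{0,1,\dots,t\}$ the coefficients $a_{-m_s}$ and $a_{-m_{s+1}}$ are nonzero and $$\beta_{m_s-m_0+1}=\cdots=\beta_{m_{s+1}-m_0}=-1-\frac{\mathrm{ord}_x(a_{-m_{s+1}})-\mathrm{ord}_x(a_{-m_s})}{m_{s+1}-m_s}.$$ -/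

import Mathlib

open scoped TensorProduct Polynomial

noncomputable section

namespace DiffMod

/-! ### Differential rings and twisted polynomials -/

/-- A derivation of the commutative ring `R`: an additive map satisfying the Leibniz rule. The
pair `(R, d)` is a differential ring. -/
structure AddDerivation (R : Type*) [CommRing R] extends R →+ R where
  leibniz : ∀ a b : R, toFun (a * b) = a * toFun b + b * toFun a

namespace AddDerivation

variable {R : Type*} [CommRing R]

instance : FunLike (AddDerivation R) R R where
  coe d := d.toFun
  coe_injective := by
    intro d d' h
    cases d
    cases d'
    congr
    exact DFunLike.coe_injective h

instance : AddMonoidHomClass (AddDerivation R) R R where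
  map_add d := d.map_add'
  map_zero d := d.map_zero'

theorem apply_mul (d : AddDerivation R) (a b : R) : d (a * b) = a * d b + b * d a := d.leibniz a b

theorem apply_one (d : AddDerivation R) : d 1 = 0 := by
  have h := d.apply_mul 1 1
  rw [mul_one, one_mul] at h
  exact left_eq_add.mp h

end AddDerivation

section Twisted

variable {R : Type*} [CommRing R] (d : AddDerivation R)

/-- The ring `R{T}` of twisted polynomials `∑ aᵢ Tⁱ` over the differential ring `(R, d)`. The
underlying `R`-module is that of the polynomials over `R`; the multiplication is determined by
`T * a = a * T + d a`. -/
def TwistedPolynomial {R : Type*} [CommRing R] (_d : AddDerivation R) : Type _ := R[X]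

namespace TwistedPolynomial

instance : AddCommGroup (TwistedPolynomial d) := inferInstanceAs (AddCommGroup R[X])

instance : Module R (TwistedPolynomial d) := inferInstanceAs (Module R R[X])

/-- The polynomial `∑ aᵢ tⁱ` with the same coefficients as the twisted polynomial `∑ aᵢ Tⁱ`. -/
def toPoly : TwistedPolynomial d ≃ₗ[R] R[X] := LinearEquiv.refl R R[X]

/-- The coefficient `aᵢ` of `∑ aᵢ Tⁱ`. -/
def coeff {d : AddDerivation R} (p : TwistedPolynomial d) (i : ℕ) : R := (toPoly d p).coeff i

/-- The degree in `T`. -/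
def natDegree {d : AddDerivation R} (p : TwistedPolynomial d) : ℕ := (toPoly d p).natDegree

/-- The coefficient of the highest power of `T` is `1`. -/
def Monic {d : AddDerivation R} (p : TwistedPolynomial d) : Prop := (toPoly d p).Monic

/-- Apply `d` to every coefficient. -/
def dCoeff : R[X] →+ R[X] where
  toFun p := p.sum fun i a => Polynomial.monomial i (d a)
  map_zero' := Polynomial.sum_zero_index _
  map_add' p q := Polynomial.sum_add_index p q _ (by simp) (by simp)

theorem dCoeff_monomial (i : ℕ) (a : R) :
    dCoeff d (Polynomial.monomial i a) = Polynomial.monomial i (d a) :=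
  Polynomial.sum_monomial_index a (fun i a => Polynomial.monomial i (d a)) (by simp)

/-- Left multiplication by `T`: it sends `∑ aᵢ Tⁱ` to `∑ (aᵢ Tⁱ⁺¹ + d(aᵢ) Tⁱ)`. -/
def mulT : AddMonoid.End R[X] := AddMonoidHom.mulLeft Polynomial.X + dCoeff d

theorem mulT_monomial (i : ℕ) (a : R) :
    mulT d (Polynomial.monomial i a) =
      Polynomial.monomial (i + 1) a + Polynomial.monomial i (d a) := by
  have h : mulT d (Polynomial.monomial i a) =
    Polynomial.X * Polynomial.monomial i a + dCoeff d (Polynomial.monomial i a) := rfl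
  rw [h, dCoeff_monomial, Polynomial.X_mul_monomial]

/-- Left multiplication by `∑ aᵢ Tⁱ`, namely `∑ aᵢ • (mulT)ⁱ`. -/
def mulEnd : R[X] →+ AddMonoid.End R[X] :=
  Polynomial.eval₂AddMonoidHom (Module.toAddMonoidEnd R R[X]) (mulT d)

theorem mulEnd_monomial (i : ℕ) (a : R) :
    mulEnd d (Polynomial.monomial i a) = Module.toAddMonoidEnd R R[X] a * mulT d ^ i :=
  Polynomial.eval₂_monomial _ _

theorem mulT_comp_smul (a : R) :
    mulT d * Module.toAddMonoidEnd R R[X] a =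
      Module.toAddMonoidEnd R R[X] a * mulT d + Module.toAddMonoidEnd R R[X] (d a) := by
  refine Polynomial.addHom_ext fun i b => ?_
  change mulT d (a • Polynomial.monomial i b) =
    a • mulT d (Polynomial.monomial i b) + d a • Polynomial.monomial i b
  rw [Polynomial.smul_monomial, mulT_monomial, mulT_monomial, smul_add,
    Polynomial.smul_monomial, Polynomial.smul_monomial, Polynomial.smul_monomial, add_assoc,
    ← map_add]
  simp [d.apply_mul, mul_comm]

theorem mulEnd_mulT (q : R[X]) : mulEnd d (mulT d q) = mulT d * mulEnd d q := by
  induction q using Polynomial.induction_on' with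
  | add p q hp hq => rw [map_add, map_add, map_add, hp, hq, mul_add]
  | monomial i a =>
    rw [mulT_monomial, map_add, mulEnd_monomial, mulEnd_monomial, mulEnd_monomial, ← mul_assoc,
      mulT_comp_smul, add_mul, pow_succ', mul_assoc]

theorem mulEnd_smul (a : R) (q : R[X]) :
    mulEnd d (a • q) = Module.toAddMonoidEnd R R[X] a * mulEnd d q := by
  induction q using Polynomial.induction_on' with
  | add p q hp hq => rw [smul_add, map_add, map_add, hp, hq, mul_add]
  | monomial i b =>
    rw [Polynomial.smul_monomial, mulEnd_monomial, mulEnd_monomial, smul_eq_mul, map_mul,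
      mul_assoc]

theorem mulEnd_mulEnd (p q : R[X]) : mulEnd d (mulEnd d p q) = mulEnd d p * mulEnd d q := by
  induction p using Polynomial.induction_on' with
  | add p₁ p₂ h₁ h₂ =>
    have e : mulEnd d (p₁ + p₂) q = mulEnd d p₁ q + mulEnd d p₂ q :=
      DFunLike.congr_fun ((mulEnd d).map_add p₁ p₂) q
    rw [e, map_add, map_add, h₁, h₂, add_mul]
  | monomial i a =>
    rw [mulEnd_monomial]
    change mulEnd d (a • (mulT d ^ i) q) = _
    rw [mulEnd_smul, mul_assoc]
    congr 1
    induction i with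
    | zero => simp
    | succ i ih =>
      rw [pow_succ']
      change mulEnd d (mulT d ((mulT d ^ i) q)) = _
      rw [mulEnd_mulT, ih, mul_assoc]

theorem mulEnd_one : mulEnd d 1 = 1 := by
  have h := mulEnd_monomial d 0 1
  rw [pow_zero, mul_one, (Module.toAddMonoidEnd R R[X]).map_one] at h
  exact h

theorem mulEnd_apply_one (p : R[X]) : mulEnd d p 1 = p := by
  induction p using Polynomial.induction_on' with
  | add p q hp hq =>
    rw [map_add]
    exact congrArg₂ (· + ·) hp hq
  | monomial i a =>
    rw [mulEnd_monomial]
    change a • (mulT d ^ i) 1 = _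
    have h : (mulT d ^ i) (1 : R[X]) = Polynomial.monomial i 1 := by
      induction i with
      | zero => rfl
      | succ i ih =>
        rw [pow_succ']
        change mulT d ((mulT d ^ i) 1) = _
        rw [ih, mulT_monomial]
        simp [d.apply_one]
    rw [h, Polynomial.smul_monomial, smul_eq_mul, mul_one]

instance : Ring (TwistedPolynomial d) where
  __ := (inferInstance : AddCommGroup (TwistedPolynomial d))
  mul p q := mulEnd d p q
  one := (1 : R[X])
  left_distrib p q r := (mulEnd d p).map_add q r
  right_distrib p q r := DFunLike.congr_fun ((mulEnd d).map_add p q) r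
  zero_mul p := DFunLike.congr_fun (mulEnd d).map_zero p
  mul_zero p := (mulEnd d p).map_zero
  mul_assoc p q r := DFunLike.congr_fun (mulEnd_mulEnd d p q) r
  one_mul p := DFunLike.congr_fun (mulEnd_one d) p
  mul_one p := mulEnd_apply_one d p

instance : IsScalarTower R (TwistedPolynomial d) (TwistedPolynomial d) where
  smul_assoc a p q := DFunLike.congr_fun (mulEnd_smul d a p) q

/-- The variable `T`. -/
def T : TwistedPolynomial d := (toPoly d).symm Polynomial.X

theorem T_mul_smul (a : R) (p : TwistedPolynomial d) :
    T d * (a • p) = a • (T d * p) + d a • p := by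
  have h : mulEnd d Polynomial.X = mulT d := by
    have h := mulEnd_monomial d 1 1
    rwa [pow_one, (Module.toAddMonoidEnd R R[X]).map_one, one_mul] at h
  change mulEnd d Polynomial.X (a • toPoly d p) =
    a • mulEnd d Polynomial.X (toPoly d p) + d a • toPoly d p
  rw [h]
  exact DFunLike.congr_fun (mulT_comp_smul d a) p

end TwistedPolynomial

end Twisted

/-! ### Differential modules -/

/-- A differential operator on the `R`-module `M` relative to the derivation `d` of `R`; an
`R`-module together with such an operator is a differential module over `(R, d)`. -/
structure DifferentialOperator {R : Type*} [CommRing R] (d : AddDerivation R)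
    (M : Type*) [AddCommGroup M] [Module R M] extends M →+ M where
  leibniz : ∀ (a : R) (m : M), toFun (a • m) = a • toFun m + d a • m

/-- The left `R{T}`-module `R{T} / R{T}ℓ`. -/
abbrev CyclicModule {R : Type*} [CommRing R] {d : AddDerivation R}
    (ℓ : TwistedPolynomial d) : Type _ :=
  TwistedPolynomial d ⧸ Submodule.span (TwistedPolynomial d) {ℓ}

/-- Left multiplication by `T` makes `R{T} / R{T}ℓ` a differential module over `(R, d)`. -/
def cyclicOperator {R : Type*} [CommRing R] {d : AddDerivation R}
    (ℓ : TwistedPolynomial d) : DifferentialOperator d (CyclicModule ℓ) where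
  toFun m := TwistedPolynomial.T d • m
  map_zero' := smul_zero _
  map_add' := smul_add _
  leibniz a m := by
    obtain ⟨p, rfl⟩ := Submodule.Quotient.mk_surjective _ m
    exact congrArg (Submodule.Quotient.mk (p := Submodule.span (TwistedPolynomial d) {ℓ}))
      (TwistedPolynomial.T_mul_smul d a p)

/-- Base change of a differential module `(M, D)` along a morphism `(R, d) → (S, e)` of
differential rings: the operator `b ⊗ m ↦ e b ⊗ m + b ⊗ D m` on `S ⊗ M`. -/
def DifferentialOperator.baseChange {R S M : Type*} [CommRing R] [CommRing S] [Algebra R S]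
    [AddCommGroup M] [Module R M] {d : AddDerivation R} (D : DifferentialOperator d M)
    (e : AddDerivation S) (he : ∀ a : R, e (algebraMap R S a) = algebraMap R S (d a)) :
    DifferentialOperator e (S ⊗[R] M) where
  toAddMonoidHom := TensorProduct.liftAddHom
    (AddMonoidHom.mk' (fun b => AddMonoidHom.mk' (fun m => e b ⊗ₜ[R] m + b ⊗ₜ[R] D.toFun m)
        fun m m' => by
          have h : D.toFun (m + m') = D.toFun m + D.toFun m' := D.map_add' m m'
          rw [h, TensorProduct.tmul_add, TensorProduct.tmul_add]; abel)
      fun b b' => by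
        ext m
        simp only [AddMonoidHom.mk'_apply, AddMonoidHom.add_apply, map_add,
          TensorProduct.add_tmul]
        abel)
    fun a b m => by
      have h : D.toFun (a • m) = a • D.toFun m + d a • m := D.leibniz a m
      have h' : e (a • b) = a • e b + d a • b := by
        rw [Algebra.smul_def, AddDerivation.apply_mul, he, Algebra.smul_def, Algebra.smul_def,
          mul_comm b]
      simp only [AddMonoidHom.mk'_apply, h, h', TensorProduct.tmul_add, TensorProduct.add_tmul,
        TensorProduct.smul_tmul]
      abel
  leibniz b z := by
    induction z using TensorProduct.induction_on with
    | zero =>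
      have key : ∀ f : S ⊗[R] M →+ S ⊗[R] M,
          f (b • (0 : S ⊗[R] M)) = b • f 0 + e b • (0 : S ⊗[R] M) := by simp
      exact key _
    | tmul b' m =>
      change e (b * b') ⊗ₜ[R] m + (b * b') ⊗ₜ[R] D.toFun m =
        b • (e b' ⊗ₜ[R] m + b' ⊗ₜ[R] D.toFun m) + (e b * b') ⊗ₜ[R] m
      simp only [AddDerivation.apply_mul, smul_eq_mul, TensorProduct.add_tmul, smul_add,
        TensorProduct.smul_tmul', mul_comm b' (e b)]
      abel
    | add z z' h h' =>
      have key : ∀ (f : S ⊗[R] M →+ S ⊗[R] M),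
          f (b • z) = b • f z + e b • z → f (b • z') = b • f z' + e b • z' →
          f (b • (z + z')) = b • f (z + z') + e b • (z + z') := by
        intro f h₁ h₂
        rw [smul_add, map_add, h₁, h₂, map_add, smul_add, smul_add]
        abel
      exact key _ h h'

/-! ### Laurent series -/

theorem derivative_leibniz {F : Type*} [Field F] (f g : LaurentSeries F) :
    LaurentSeries.derivative F (f * g) =
      f * LaurentSeries.derivative F g + g * LaurentSeries.derivative F f := by
  -- the Euler operator `x d/dx` preserves supports
  let θ : LaurentSeries F → LaurentSeries F := fun h =>
    { coeff := fun n => (n : F) * h.coeff n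
      isPWO_support' := h.isPWO_support.mono fun n hn hz => hn (by
        change h.coeff n = 0 at hz
        simp [hz]) }
  have hsupp : ∀ h : LaurentSeries F, (θ h).support ⊆ h.support := fun h n hn hz => hn (by
    change h.coeff n = 0 at hz
    change (n : F) * h.coeff n = 0
    simp [hz])
  have hd : ∀ h : LaurentSeries F,
      LaurentSeries.derivative F h = HahnSeries.single (-1) (1 : F) * θ h := by
    intro h
    ext n
    rw [show n = (n + 1) + -1 by ring, HahnSeries.coeff_single_mul_add]
    simp [θ]
  have hθ : θ (f * g) = f * θ g + g * θ f := by
    ext n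
    rw [mul_comm g, HahnSeries.coeff_add, HahnSeries.coeff_mul_right' g.isPWO_support (hsupp g),
      HahnSeries.coeff_mul_left' f.isPWO_support (hsupp f), ← Finset.sum_add_distrib]
    change (n : F) * (f * g).coeff n = _
    rw [HahnSeries.coeff_mul, Finset.mul_sum]
    refine Finset.sum_congr rfl fun ij hij => ?_
    have hn : ij.1 + ij.2 = n := (Finset.mem_antidiagonal.mp hij).2.2
    change _ = f.coeff ij.1 * ((ij.2 : F) * g.coeff ij.2) + (ij.1 : F) * f.coeff ij.1 * g.coeff ij.2
    rw [← hn]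
    push_cast
    ring
  rw [hd, hd, hd, hθ]
  ring

/-- The derivation `d/dx` of the field `F((x))`. -/
def ddx (F : Type*) [Field F] : AddDerivation (LaurentSeries F) where
  toAddMonoidHom := (LaurentSeries.derivative F).toAddMonoidHom
  leibniz := derivative_leibniz

/-- The field `k̄((x^{1/N}))`, where `k̄` is an algebraic closure of `k`; it consists of the Laurent
series over `k̄` in the variable `t = x^{1/N}`. -/
def RamifiedField (k : Type*) [Field k] (_N : ℕ+) : Type _ := LaurentSeries (AlgebraicClosure k)

namespace RamifiedField

variable (k : Type*) [Field k] (N : ℕ+)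

instance : Field (RamifiedField k N) := inferInstanceAs (Field (LaurentSeries (AlgebraicClosure k)))

/-- The identification with Laurent series in `t = x^{1/N}`. -/
def toLaurent : RamifiedField k N ≃+* LaurentSeries (AlgebraicClosure k) := RingEquiv.refl _

/-- The inclusion `k((x)) → k̄((x))`. -/
def mapCoeff : LaurentSeries k →+* LaurentSeries (AlgebraicClosure k) where
  toFun f := f.map (algebraMap k (AlgebraicClosure k))
  map_zero' := by ext; simp
  map_one' := by
    ext n
    simp only [HahnSeries.map_coeff, HahnSeries.coeff_one]
    split <;> simp
  map_add' f g := by ext; simp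
  map_mul' f g :=
    HahnSeries.map_mul ((algebraMap k (AlgebraicClosure k)) : k →ₙ+* AlgebraicClosure k)

/-- The inclusion `k((x)) → k̄((t))`, `∑ aᵢ xⁱ ↦ ∑ aᵢ t^{N i}`. -/
def inclusion : LaurentSeries k →+* RamifiedField k N :=
  ((toLaurent k N).symm : LaurentSeries (AlgebraicClosure k) →+* RamifiedField k N).comp
    ((HahnSeries.embDomainRingHom (AddMonoidHom.mulLeft ((N : ℕ) : ℤ))
      (mul_right_injective₀ (by simp))
      fun _ _ => mul_le_mul_iff_of_pos_left (by simp)).comp (mapCoeff k))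

instance : Algebra (LaurentSeries k) (RamifiedField k N) := (inclusion k N).toAlgebra

/-- The derivation `d/dx = (N t^{N-1})⁻¹ d/dt` of `k̄((t))`, where `x = t^N`. -/
def ddx : AddDerivation (RamifiedField k N) where
  toFun f := (toLaurent k N).symm
    (HahnSeries.single (1 - ((N : ℕ) : ℤ)) ((N : ℕ) : AlgebraicClosure k)⁻¹ *
      DiffMod.ddx (AlgebraicClosure k) (toLaurent k N f))
  map_zero' := by simp
  map_add' f g := by simp [mul_add]
  leibniz f g := by
    apply (toLaurent k N).injective
    simp only [map_mul, map_add, RingEquiv.apply_symm_apply, AddDerivation.apply_mul]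
    ring

theorem ddx_algebraMap [CharZero k] (f : LaurentSeries k) :
    ddx k N (algebraMap (LaurentSeries k) (RamifiedField k N) f) =
      algebraMap (LaurentSeries k) (RamifiedField k N) (DiffMod.ddx k f) := by
  have hN : (((N : ℕ) : AlgebraicClosure k)) ≠ 0 := by
    have : CharZero (AlgebraicClosure k) :=
      charZero_of_injective_algebraMap (algebraMap k (AlgebraicClosure k)).injective
    simp
  have hN' : ((N : ℕ) : ℤ) ≠ 0 := by simp
  have hc : ∀ (g : LaurentSeries k) (i : ℤ),
      (toLaurent k N (algebraMap (LaurentSeries k) (RamifiedField k N) g)).coeff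
        (((N : ℕ) : ℤ) * i) = algebraMap k (AlgebraicClosure k) (g.coeff i) := fun g i =>
    HahnSeries.embDomain_coeff (a := i)
  have hc' : ∀ (g : LaurentSeries k) (n : ℤ), ¬ ((N : ℕ) : ℤ) ∣ n →
      (toLaurent k N (algebraMap (LaurentSeries k) (RamifiedField k N) g)).coeff n = 0 := by
    intro g n hn
    refine HahnSeries.embDomain_of_notMem_range ?_
    rintro ⟨i, rfl⟩
    exact hn ⟨i, rfl⟩
  apply (toLaurent k N).injective
  ext n
  have hl : (toLaurent k N (ddx k N (algebraMap (LaurentSeries k) (RamifiedField k N) f))).coeff n =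
      ((N : ℕ) : AlgebraicClosure k)⁻¹ * (((n + (N : ℕ) : ℤ) : AlgebraicClosure k) *
        (toLaurent k N (algebraMap (LaurentSeries k) (RamifiedField k N) f)).coeff
          (n + ((N : ℕ) : ℤ))) := by
    change (HahnSeries.single (1 - ((N : ℕ) : ℤ)) ((N : ℕ) : AlgebraicClosure k)⁻¹ *
      LaurentSeries.derivative (AlgebraicClosure k) (toLaurent k N
        (algebraMap (LaurentSeries k) (RamifiedField k N) f))).coeff n = _
    rw [show n = (n + (N : ℕ) - 1) + (1 - ((N : ℕ) : ℤ)) by ring, HahnSeries.coeff_single_mul_add]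
    simp
  rw [hl]
  by_cases hn : ((N : ℕ) : ℤ) ∣ n
  · obtain ⟨i, rfl⟩ := hn
    have h : (DiffMod.ddx k f).coeff i = ((i + 1 : ℤ) : k) * f.coeff (i + 1) := by
      change (LaurentSeries.derivative k f).coeff i = _
      simp
    rw [hc, h, show ((N : ℕ) : ℤ) * i + ((N : ℕ) : ℤ) = ((N : ℕ) : ℤ) * (i + 1) by ring, hc]
    push_cast
    field_simp
    simp [mul_comm]
  · rw [hc' _ _ hn, hc' _ _ (by simpa using hn)]
    simp

/-- The extension of `ord_x` to `k̄((x^{1/N}))`, for a nonzero element (at `0` the value is `0`). -/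
def ord (f : RamifiedField k N) : ℚ := ((toLaurent k N f).order : ℚ) / ((N : ℕ) : ℚ)

end RamifiedField

/-! ### Formal slopes -/

/-- The formal slope of the differential module of rank one with generator `e`, `D e = f e`, over
`(k̄((x^{1/N})), d/dx)`, namely `max (0, -1 - ord_x f)`; it is `0` for `f = 0`. -/
def rankOneSlope (k : Type*) [Field k] (N : ℕ+) (f : RamifiedField k N) : ℚ :=
  max 0 (-1 - RamifiedField.ord k N f)

/-- `s` is the multiset of formal slopes of the differential module `(M, D)` over
`(k((x)), d/dx)`: for some `N`, the base change of `M` to `k̄((x^{1/N}))` has a filtration by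
differential submodules with graded pieces of rank one (the existence of which is the theorem of
Turrittin and Levelt), and `s` consists of the slopes of the graded pieces. The filtration is
given by a basis `e₀, e₁, …`, its members being the spans of the initial segments of the basis,
and the `i`-th graded piece is generated by a vector `ē` with `D ē = fᵢ ē`. -/
def IsFormalSlopes {k : Type*} [Field k] [CharZero k] {M : Type*} [AddCommGroup M]
    [Module (LaurentSeries k) M] (D : DifferentialOperator (ddx k) M) (s : Multiset ℚ) : Prop :=
  ∃ (N : ℕ+) (r : ℕ)
    (e : Module.Basis (Fin r) (RamifiedField k N) (RamifiedField k N ⊗[LaurentSeries k] M))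
    (f : Fin r → RamifiedField k N),
    (∀ i, (D.baseChange (RamifiedField.ddx k N) (RamifiedField.ddx_algebraMap k N)).toFun (e i) -
        f i • e i ∈ Submodule.span (RamifiedField k N) (e '' Set.Iio i)) ∧
    s = Finset.univ.val.map fun i => rankOneSlope k N (f i)

/-! ### Analytic functions on the punctured disc and Gauss norms -/

section Analytic

variable {k : Type*} [NormedField k]

/-- The ring `A_{γ,x} = A_γ[x⁻¹]`, as a subring of `k((x))`, where `A_γ` is the ring of the power
series `∑ aᵢ xⁱ` over `k` with `|aᵢ| γⁱ → 0`. -/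
def analyticRing (k : Type*) [NormedField k] [IsUltrametricDist k] (γ : ℝ) :
    Subring (LaurentSeries k) where
  carrier := {f | ∃ (m : ℕ) (g : PowerSeries k), PowerSeries.IsRestricted γ g ∧
    f = HahnSeries.single (-(m : ℤ)) (1 : k) * HahnSeries.ofPowerSeries ℤ k g}
  zero_mem' := ⟨0, 0, PowerSeries.isRestricted_zero γ, by simp⟩
  one_mem' := ⟨0, 1, PowerSeries.isRestricted_one γ, by simp⟩
  neg_mem' := by
    rintro _ ⟨m, g, hg, rfl⟩
    exact ⟨m, -g, PowerSeries.isRestricted.neg γ hg, by simp⟩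
  mul_mem' := by
    rintro _ _ ⟨m, g, hg, rfl⟩ ⟨m', g', hg', rfl⟩
    refine ⟨m + m', g * g', PowerSeries.isRestricted.mul γ hg hg', ?_⟩
    have h : HahnSeries.single (-((m + m' : ℕ) : ℤ)) (1 : k) =
        HahnSeries.single (-(m : ℤ)) 1 * HahnSeries.single (-(m' : ℤ)) 1 := by
      rw [HahnSeries.single_mul_single, mul_one]
      push_cast
      ring_nf
    rw [h, RingHom.map_mul]
    ring
  add_mem' := by
    rintro _ _ ⟨m, g, hg, rfl⟩ ⟨m', g', hg', rfl⟩
    have hX : ∀ i : ℕ, PowerSeries.IsRestricted γ (PowerSeries.X ^ i : PowerSeries k) := by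
      intro i
      rw [PowerSeries.X_pow_eq]
      exact PowerSeries.isRestricted_monomial γ i 1
    refine ⟨m + m', PowerSeries.X ^ m' * g + PowerSeries.X ^ m * g',
      PowerSeries.isRestricted.add γ (PowerSeries.isRestricted.mul γ (hX m') hg)
        (PowerSeries.isRestricted.mul γ (hX m) hg'), ?_⟩
    have h : ∀ i j : ℕ, HahnSeries.single (-((i + j : ℕ) : ℤ)) (1 : k) *
        HahnSeries.single (j : ℤ) 1 = HahnSeries.single (-(i : ℤ)) 1 := by
      intro i j
      rw [HahnSeries.single_mul_single, mul_one]
      push_cast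
      ring_nf
    have h₂ := h m' m
    rw [add_comm m' m] at h₂
    rw [RingHom.map_add, RingHom.map_mul, RingHom.map_mul, HahnSeries.ofPowerSeries_X_pow,
      HahnSeries.ofPowerSeries_X_pow, mul_add, ← mul_assoc, ← mul_assoc, h m m', h₂]

/-- The `ρ`-Gauss norm `|∑ aᵢ xⁱ|_ρ = supᵢ |aᵢ| ρⁱ`; the supremum is finite on `A_{γ,x}` for
`0 < ρ ≤ γ`. -/
def gaussNorm (ρ : ℝ) (f : LaurentSeries k) : ℝ := ⨆ i : ℤ, ‖f.coeff i‖ * ρ ^ i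

/-! ### Newton polygons -/

/-- The points `(-i, v_ρ(aᵢ))` with `0 ≤ i ≤ n` and `v_ρ(aᵢ) = -log |aᵢ|_ρ < ∞`, for
`ℓ = ∑ aᵢ Tⁱ` of degree `n`. -/
def newtonPoints (ρ : ℝ) (ℓ : TwistedPolynomial (ddx k)) : Set (ℝ × ℝ) :=
  {P | ∃ i : ℕ, i ≤ ℓ.natDegree ∧ ℓ.coeff i ≠ 0 ∧
    P = (-(i : ℝ), -Real.log (gaussNorm ρ (ℓ.coeff i)))}

/-- The Newton polygon `NP_ρ(ℓ)`, i.e. the lower boundary of the convex hull of the points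
`(-i, v_ρ(aᵢ))`, as a function on `[-n, 0]`. Its value is `∞` where the vertical line does not meet
the convex hull; on `[-n, 0]` this happens only if `a₀ = 0`, between the last nonzero term
and `0`. -/
def newtonPolygon (ρ : ℝ) (ℓ : TwistedPolynomial (ddx k)) (y : ℝ) : EReal :=
  ⨅ z ∈ {z : ℝ | (y, z) ∈ convexHull ℝ (newtonPoints ρ ℓ)}, (z : EReal)

/-- The slope of `NP_ρ(ℓ)` on the interval `[u, w]`. -/
def newtonSlope (ρ : ℝ) (ℓ : TwistedPolynomial (ddx k)) (u w : ℤ) : EReal :=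
  (newtonPolygon ρ ℓ w - newtonPolygon ρ ℓ u) / (((w : ℝ) - (u : ℝ) : ℝ) : EReal)

/-- The breaks of `NP_ρ(ℓ)`: the integers `-n` and `0`, and the integers `-n < m < 0` such that the
slope on `[m-1, m]` is strictly smaller than the slope on `[m, m+1]`. -/
def newtonBreaks (ρ : ℝ) (ℓ : TwistedPolynomial (ddx k)) : Set ℤ :=
  {m | m = -(ℓ.natDegree : ℤ) ∨ m = 0 ∨ (-(ℓ.natDegree : ℤ) < m ∧ m < 0 ∧
    newtonSlope ρ ℓ (m - 1) m < newtonSlope ρ ℓ m (m + 1))}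

/-- The slope of `NP_ρ(ℓ)` on `[u, w]` is effective if it is smaller than
`-log |d/dx|_{F_ρ} = log ρ`. -/
def IsEffective (ρ : ℝ) (ℓ : TwistedPolynomial (ddx k)) (u w : ℤ) : Prop :=
  newtonSlope ρ ℓ u w < (Real.log ρ : EReal)

/-- The real number `c` is small enough for `ℓ = ∑ aᵢ Tⁱ`, of degree `n` with coefficients in
`A_{γ,x}`. Here `bᵢ` is the lowest coefficient of the Laurent series `aᵢ`; the conditions involve
only those indices for which `aᵢ ≠ 0`, since `bᵢ` makes sense only for these. -/
structure IsSmallRadius (γ : ℝ) (ℓ : TwistedPolynomial (ddx k)) (c : ℝ) : Prop where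
  pos : 0 < c
  le : c ≤ γ
  lt_one : c < 1
  gaussNorm_eq : ∀ ρ : ℝ, 0 < ρ → ρ ≤ c → ∀ i ≤ ℓ.natDegree, ℓ.coeff i ≠ 0 →
    gaussNorm ρ (ℓ.coeff i) = ‖(ℓ.coeff i).leadingCoeff‖ * ρ ^ (ℓ.coeff i).order
  triple : ∀ ρ : ℝ, 0 < ρ → ρ ≤ c → ∀ h i j : ℕ, h < i → i ≤ j → j ≤ ℓ.natDegree →
    ℓ.coeff h ≠ 0 → ℓ.coeff i ≠ 0 → ℓ.coeff j ≠ 0 →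
    |Real.log
        ((‖(ℓ.coeff i).leadingCoeff‖ / ‖(ℓ.coeff h).leadingCoeff‖) ^ (1 / ((i : ℝ) - (h : ℝ))) *
          (‖(ℓ.coeff h).leadingCoeff‖ / ‖(ℓ.coeff j).leadingCoeff‖) ^ (1 / ((j : ℝ) - (h : ℝ)))) /
      (-Real.log ρ)| < 1 / ((ℓ.natDegree : ℝ) ^ 2 + 1)
  pair : ∀ ρ : ℝ, 0 < ρ → ρ ≤ c → ∀ i j : ℕ, i < j → j ≤ ℓ.natDegree →
    ℓ.coeff i ≠ 0 → ℓ.coeff j ≠ 0 →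
    |Real.log
        ((‖(ℓ.coeff j).leadingCoeff‖ / ‖(ℓ.coeff i).leadingCoeff‖) ^ (1 / ((j : ℝ) - (i : ℝ)))) /
      (-Real.log ρ)| < 1 / ((ℓ.natDegree : ℝ) + 1)

end Analytic

end DiffMod

end

open DiffMod

/-! Two polygons are compared: `NP_ρ(ℓ)`, with heights `v_ρ(aᵢ)`, and the formal polygon, with
heights `ord_x(aᵢ)`.

Analytic side. Put `L = -log ρ > 0`. For small `ρ` one has `v_ρ(aᵢ) = L ord_x(aᵢ) - log |bᵢ|`. The
relative position of three points is the sign of a determinant (`cross`) that is linear in the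
heights. Its value on the orders is an integer, and condition (ii) makes its value on the `log |bᵢ|`
smaller than `L` in absolute value. Hence the integer decides the sign unless it is `0`, and then
the part from `log |bᵢ|` decides; neither depends on `ρ`. So the breaks are constant
(`IsSmallRadius.cross_height_pos_iff`), and the endpoints of an edge of `NP_c(ℓ)` also span a
supporting line of the formal polygon (`IsSmallRadius.cross_orderReal_nonneg`). The same integrality
argument with (iii) shows that an effective edge from `-i` to `-h` satisfies `(ord aᵢ - ord aₕ) / (i
- h) ≥ 1` (`IsSmallRadius.one_le_formal_slope`).

Formal side. For the absolute value `exp (-ord_x)` on `k̄((x^{1/N}))`, the operator norm of `d/dx`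
is at most `e`. A triangular basis turns `ℓ` into a product of linear factors `T - g`, where `g`
differs from a diagonal entry by a logarithmic derivative (`exists_monic_evalAt_eq_zero`,
`eq_of_evalAt_eq_zero`). On such products the Gauss norm of radius `R > e` is multiplicative
(`IsGaussNorm.mulLinear`). Taking logarithms with `R = exp r`, for `r > 1`, `maxᵢ (r i - ord aᵢ) =
∑ⱼ max (r, 1 + βⱼ)` (`IsFormalSlopes.isGreatest`). This is the Legendre transform of the formal
polygon, and it recovers `1 + βⱼ` along every edge with `(ord aᵢ - ord aₕ) / (i - h) ≥ 1`
(`eq_slope_of_isGreatest`). By convexity, all edges to the left of an effective edge are effective.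
-/

noncomputable section

namespace DiffMod

/-! ### Gauss norms of products of linear twisted polynomials. -/

section GaussNorm

variable {K : Type*} [Field K] (d : AddDerivation K)

theorem coeff_dCoeff (p : K[X]) (i : ℕ) :
    (TwistedPolynomial.dCoeff d p).coeff i = d (p.coeff i) := by
  induction p using Polynomial.induction_on' with
  | add p q hp hq => simp [hp, hq]
  | monomial j a =>
    rw [TwistedPolynomial.dCoeff_monomial, Polynomial.coeff_monomial, Polynomial.coeff_monomial]
    split <;> simp

theorem mulT_apply (p : K[X]) :
    TwistedPolynomial.mulT d p = Polynomial.X * p + TwistedPolynomial.dCoeff d p := rfl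

theorem coeff_mulT_zero (p : K[X]) :
    (TwistedPolynomial.mulT d p).coeff 0 = d (p.coeff 0) := by
  simp [mulT_apply, coeff_dCoeff]

theorem coeff_mulT_succ (p : K[X]) (i : ℕ) :
    (TwistedPolynomial.mulT d p).coeff (i + 1) = p.coeff i + d (p.coeff (i + 1)) := by
  simp [mulT_apply, coeff_dCoeff]

theorem natDegree_dCoeff_le (p : K[X]) :
    (TwistedPolynomial.dCoeff d p).natDegree ≤ p.natDegree := by
  rw [Polynomial.natDegree_le_iff_coeff_eq_zero]
  intro i hi
  rw [coeff_dCoeff, Polynomial.coeff_eq_zero_of_natDegree_lt hi, map_zero]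

/-- The product `(T - g) p` of twisted polynomials. -/
def mulLinear (g : K) (p : K[X]) : K[X] := TwistedPolynomial.mulT d p - g • p

theorem degree_dCoeff_sub_smul_lt {p : K[X]} (hp : p.Monic) (g : K) :
    (TwistedPolynomial.dCoeff d p - g • p).degree < (Polynomial.X * p).degree := by
  have h0 : p ≠ 0 := hp.ne_zero
  have h1 : (TwistedPolynomial.dCoeff d p - g • p).natDegree ≤ p.natDegree :=
    (Polynomial.natDegree_sub_le _ _).trans
      (max_le (natDegree_dCoeff_le d p) (Polynomial.natDegree_smul_le g p))
  refine Polynomial.degree_lt_degree (h1.trans_lt ?_)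
  rw [Polynomial.natDegree_X_mul h0]
  omega

theorem mulLinear_eq (g : K) (p : K[X]) :
    mulLinear d g p = Polynomial.X * p + (TwistedPolynomial.dCoeff d p - g • p) := by
  rw [mulLinear, mulT_apply, add_sub_assoc]

theorem monic_mulLinear (g : K) {p : K[X]} (hp : p.Monic) : (mulLinear d g p).Monic := by
  rw [mulLinear_eq]
  exact (Polynomial.monic_X.mul hp).add_of_left (degree_dCoeff_sub_smul_lt d hp g)

theorem natDegree_mulLinear (g : K) {p : K[X]} (hp : p.Monic) :
    (mulLinear d g p).natDegree = p.natDegree + 1 := by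
  rw [mulLinear_eq, Polynomial.natDegree_add_eq_left_of_degree_lt
    (degree_dCoeff_sub_smul_lt d hp g), Polynomial.natDegree_X_mul hp.ne_zero]

/-- `W` is the Gauss norm `maxᵢ v(pᵢ) Rⁱ` of the polynomial `∑ pᵢ Tⁱ`. -/
def IsGaussNorm (v : AbsoluteValue K ℝ) (R : ℝ) (p : K[X]) (W : ℝ) : Prop :=
  IsGreatest (Set.range fun i => v (p.coeff i) * R ^ i) W

theorem isGaussNorm_one (v : AbsoluteValue K ℝ) (R : ℝ) : IsGaussNorm v R 1 1 := by
  refine ⟨⟨0, by simp⟩, ?_⟩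
  rintro _ ⟨i, rfl⟩
  rcases i with _ | i
  · simp
  · simp [Polynomial.coeff_one]

/-- The Gauss norm of radius `R` is multiplicative with respect to linear factors, provided that
`R` exceeds the operator norm of the derivation. -/
theorem IsGaussNorm.mulLinear {v : AbsoluteValue K ℝ} (hv : IsNonarchimedean v) {E R W : ℝ}
    (hE : ∀ a, v (d a) ≤ E * v a) (hE0 : 0 ≤ E) (hR : E < R) {p : K[X]}
    (hp : IsGaussNorm v R p W) (hW : 0 < W) (g : K) :
    IsGaussNorm v R (DiffMod.mulLinear d g p) (max R (v g) * W) := by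
  have hR0 : 0 < R := hE0.trans_lt hR
  have hle : ∀ i, v (p.coeff i) * R ^ i ≤ W := fun i => hp.2 ⟨i, rfl⟩
  have hd : ∀ i, v (d (p.coeff i)) * R ^ i ≤ E * (v (p.coeff i) * R ^ i) := fun i => by
    rw [← mul_assoc]
    exact mul_le_mul_of_nonneg_right (hE _) (by positivity)
  have hg : ∀ i, v (g * p.coeff i) * R ^ i = v g * (v (p.coeff i) * R ^ i) := fun i => by
    rw [map_mul, mul_assoc]
  have hsub : ∀ a b : K, v (a - b) ≤ max (v a) (v b) := fun a b => by
    have := hv a (-b)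
    rwa [v.map_neg, ← sub_eq_add_neg] at this
  have htail : ∀ i, v (d (p.coeff i) - g * p.coeff i) * R ^ i ≤
      max E (v g) * (v (p.coeff i) * R ^ i) := fun i => by
    have h0 : 0 ≤ v (p.coeff i) * R ^ i := by positivity
    calc _ ≤ max (v (d (p.coeff i))) (v (g * p.coeff i)) * R ^ i :=
          mul_le_mul_of_nonneg_right (hsub _ _) (by positivity)
      _ = max (v (d (p.coeff i)) * R ^ i) (v (g * p.coeff i) * R ^ i) :=
          max_mul_of_nonneg _ _ (by positivity)
      _ ≤ _ := by
        rw [max_mul_of_nonneg _ _ h0, hg]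
        exact max_le_max (hd i) le_rfl
  have hc0 : (DiffMod.mulLinear d g p).coeff 0 = d (p.coeff 0) - g * p.coeff 0 := by
    simp [DiffMod.mulLinear, coeff_mulT_zero]
  have hc : ∀ i, (DiffMod.mulLinear d g p).coeff (i + 1) =
      p.coeff i + (d (p.coeff (i + 1)) - g * p.coeff (i + 1)) := fun i => by
    simp only [DiffMod.mulLinear, Polynomial.coeff_sub, Polynomial.coeff_smul, smul_eq_mul,
      coeff_mulT_succ]
    ring
  have hER : max E (v g) ≤ max R (v g) := max_le_max hR.le le_rfl
  have htail' : ∀ i, v (d (p.coeff i) - g * p.coeff i) * R ^ i ≤ max R (v g) * W := fun i =>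
    (htail i).trans (mul_le_mul hER (hle i) (by positivity) (hR0.le.trans (le_max_left _ _)))
  have hhead : ∀ i, v (p.coeff i) * R ^ (i + 1) ≤ R * W := fun i => by
    have := mul_le_mul_of_nonneg_left (hle i) hR0.le
    calc _ = R * (v (p.coeff i) * R ^ i) := by ring
      _ ≤ _ := this
  have hv' : ∀ a b : K, ∀ i : ℕ, ∀ B : ℝ, v a * R ^ i ≤ B → v b * R ^ i ≤ B →
      v (a + b) * R ^ i ≤ B := fun a b i B ha hb =>
    (mul_le_mul_of_nonneg_right (hv a b) (by positivity)).trans (by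
      rw [max_mul_of_nonneg _ _ (by positivity)]
      exact max_le ha hb)
  have hdom : ∀ a b : K, ∀ i : ℕ, v b * R ^ i < v a * R ^ i →
      v (a + b) * R ^ i = v a * R ^ i := fun a b i h => by
    have h' : v b < v a := lt_of_mul_lt_mul_right h (by positivity)
    rw [hv.add_eq_max_of_ne h'.ne', max_eq_left h'.le]
  refine ⟨?_, ?_⟩
  -- If `v g ≤ R`, take the last index `i` attaining `W`: in the coefficient `i + 1` the term `pᵢ`
  -- strictly dominates, even when `v g = R`, because `pᵢ₊₁` falls short of `W`. If `v g > R`, any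
  -- index attaining `W` works, since `-g pᵢ` dominates both `d pᵢ` and `pᵢ₋₁`.
  · rcases le_or_gt (v g) R with hgR | hgR
    · rw [max_eq_left hgR]
      obtain ⟨i, hi, hmax⟩ : ∃ i, v (p.coeff i) * R ^ i = W ∧
          ∀ j, i < j → v (p.coeff j) * R ^ j < W := by
        have hfin : {i | v (p.coeff i) * R ^ i = W}.Finite := by
          refine (p.support.finite_toSet).subset fun i hi => ?_
          simp only [Finset.mem_coe, Polynomial.mem_support_iff]
          intro h0
          rw [Set.mem_ofPred_eq, h0, map_zero, zero_mul] at hi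
          exact hW.ne hi
        obtain ⟨i, hi⟩ := hfin.exists_maximal (by obtain ⟨i, hi⟩ := hp.1; exact ⟨i, hi⟩)
        refine ⟨i, hi.1, fun j hj => lt_of_le_of_ne (hle j) fun h => ?_⟩
        exact absurd (hi.2 h hj.le) (not_le.mpr hj)
      have hmain : v (p.coeff i) * R ^ (i + 1) = R * W := by rw [← hi]; ring
      refine ⟨i + 1, ?_⟩
      change v _ * _ = _
      rw [hc, hdom _ _ _ ?_, hmain]
      rw [hmain]
      refine (htail (i + 1)).trans_lt ?_
      have h1 : max E (v g) * (v (p.coeff (i + 1)) * R ^ (i + 1)) ≤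
          R * (v (p.coeff (i + 1)) * R ^ (i + 1)) :=
        mul_le_mul_of_nonneg_right (max_le hR.le hgR) (by positivity)
      exact h1.trans_lt (mul_lt_mul_of_pos_left (hmax _ (Nat.lt_succ_self i)) hR0)
    · rw [max_eq_right hgR.le]
      obtain ⟨i, hi⟩ := hp.1
      change v (p.coeff i) * R ^ i = W at hi
      have hmain : v (-(g * p.coeff i)) * R ^ i = v g * W := by rw [v.map_neg, hg, hi]
      have hdlt : v (d (p.coeff i)) * R ^ i < v g * W := by
        refine (hd i).trans_lt ?_
        rw [hi]
        exact mul_lt_mul_of_pos_right (hR.trans hgR) hW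
      refine ⟨i, ?_⟩
      change v _ * _ = _
      rcases i with _ | i
      · rw [hc0, sub_eq_add_neg, add_comm, hdom _ _ _ (hmain ▸ hdlt), hmain]
      · have h2 : v (p.coeff i) * R ^ (i + 1) < v g * W :=
          (hhead i).trans_lt (mul_lt_mul_of_pos_right hgR hW)
        have h3 : v (p.coeff i + d (p.coeff (i + 1))) * R ^ (i + 1) < v g * W :=
          (hv' _ _ _ _ (le_max_left _ _) (le_max_right _ _)).trans_lt (max_lt h2 hdlt)
        rw [hc, show p.coeff i + (d (p.coeff (i + 1)) - g * p.coeff (i + 1)) =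
          -(g * p.coeff (i + 1)) + (p.coeff i + d (p.coeff (i + 1))) by ring,
          hdom _ _ _ (hmain ▸ h3), hmain]
  · rintro _ ⟨i, rfl⟩
    change v _ * _ ≤ _
    rcases i with _ | i
    · rw [hc0]
      exact htail' 0
    · rw [hc]
      exact hv' _ _ _ _ ((hhead i).trans
        (mul_le_mul_of_nonneg_right (le_max_left _ _) hW.le)) (htail' _)

end GaussNorm

/-! ### Annihilating operators of a cyclic vector. -/

section Triangular

variable {K V : Type*} [Field K] {d : AddDerivation K} [AddCommGroup V] [Module K V]
  (D : DifferentialOperator d V)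

theorem DifferentialOperator.toFun_add (x y : V) : D.toFun (x + y) = D.toFun x + D.toFun y :=
  D.map_add' x y

theorem DifferentialOperator.toFun_zero : D.toFun 0 = 0 := D.map_zero'

theorem DifferentialOperator.toFun_smul (a : K) (x : V) :
    D.toFun (a • x) = a • D.toFun x + d a • x := D.leibniz a x

/-- The action `∑ pᵢ Tⁱ ↦ ∑ pᵢ Dⁱ x` of twisted polynomials on the vector `x`. -/
def evalAt (x : V) : K[X] →ₗ[K] V :=
  Polynomial.lsum fun i => LinearMap.toSpanSingleton K V (D.toFun^[i] x)

theorem evalAt_monomial (x : V) (i : ℕ) (a : K) :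
    evalAt D x (Polynomial.monomial i a) = a • D.toFun^[i] x := by
  simp [evalAt, Polynomial.lsum_apply]

theorem evalAt_mulT (x : V) (p : K[X]) :
    evalAt D x (TwistedPolynomial.mulT d p) = D.toFun (evalAt D x p) := by
  induction p using Polynomial.induction_on' with
  | add p q hp hq => rw [map_add, map_add, map_add, D.toFun_add, hp, hq]
  | monomial i a =>
    rw [TwistedPolynomial.mulT_monomial, map_add, evalAt_monomial, evalAt_monomial,
      evalAt_monomial, D.toFun_smul, Function.iterate_succ_apply']

theorem evalAt_mulLinear (x : V) (g : K) (p : K[X]) :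
    evalAt D x (mulLinear d g p) = D.toFun (evalAt D x p) - g • evalAt D x p := by
  rw [mulLinear, map_sub, evalAt_mulT, map_smul]

/-- A triangular basis provides an annihilating operator that is a product of linear factors; its
Gauss norms are determined by the diagonal. -/
theorem exists_monic_evalAt_eq_zero {v : AbsoluteValue K ℝ} (hv : IsNonarchimedean v) {E : ℝ}
    (hE0 : 0 ≤ E) (hE : ∀ a, v (d a) ≤ E * v a) {r : ℕ} (e : Module.Basis (Fin r) K V)
    (f : Fin r → K)
    (hf : ∀ i, D.toFun (e i) - f i • e i ∈ Submodule.span K (e '' Set.Iio i)) (x : V) :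
    ∃ P : K[X], P.Monic ∧ P.natDegree = r ∧ evalAt D x P = 0 ∧
      ∀ R, E < R → IsGaussNorm v R P (∏ i, max R (v (f i))) := by
  -- The flag spanned by the initial segments of the basis; triangularity makes it stable under `D`.
  let F : ℕ → Submodule K V := fun j => Submodule.span K (e '' {i : Fin r | (i : ℕ) < j})
  have hF : ∀ j, ∀ y ∈ F j, D.toFun y ∈ F j := by
    intro j y hy
    induction hy using Submodule.span_induction with
    | mem y hy =>
      obtain ⟨i, hi, rfl⟩ := hy
      have h1 : D.toFun (e i) - f i • e i ∈ F j :=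
        Submodule.span_mono (Set.image_mono fun l hl => lt_trans (Fin.lt_def.mp hl) hi) (hf i)
      have h2 : f i • e i ∈ F j :=
        Submodule.smul_mem _ _ (Submodule.subset_span ⟨i, hi, rfl⟩)
      simpa using add_mem h1 h2
    | zero => rw [D.toFun_zero]; exact zero_mem _
    | add y z _ _ hy hz => rw [D.toFun_add]; exact add_mem hy hz
    | smul a y hy' hy =>
      rw [D.toFun_smul]
      exact add_mem (Submodule.smul_mem _ _ hy) (Submodule.smul_mem _ _ hy')
  -- Each linear factor pushes the image of `x` one step down the flag, so `r` factors annihilate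
  -- it.
  have key : ∀ m, m ≤ r → ∃ P : K[X], P.Monic ∧ P.natDegree = m ∧ evalAt D x P ∈ F (r - m) ∧
      ∀ R, E < R → IsGaussNorm v R P
        (∏ i ∈ Finset.univ.filter fun i : Fin r => r - m ≤ (i : ℕ), max R (v (f i))) := by
    intro m
    induction m with
    | zero =>
      intro _
      refine ⟨1, Polynomial.monic_one, Polynomial.natDegree_one, ?_, fun R _ => ?_⟩
      · have : {i : Fin r | (i : ℕ) < r - 0} = Set.univ := by ext i; simp
        simp only [F, this, Set.image_univ, e.span_eq]
        trivial
      · have : (Finset.univ.filter fun i : Fin r => r - 0 ≤ (i : ℕ)) = ∅ := by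
          ext i; simp
        rw [this, Finset.prod_empty]
        exact isGaussNorm_one v R
    | succ m ih =>
      intro hm
      obtain ⟨P, hP, hdeg, hev, hnorm⟩ := ih (by omega)
      let j : Fin r := ⟨r - (m + 1), by omega⟩
      have hset : {i : Fin r | (i : ℕ) < r - m} = insert j {i : Fin r | (i : ℕ) < r - (m + 1)} := by
        ext i
        simp only [Set.mem_ofPred_eq, Set.mem_insert_iff, Fin.ext_iff, j]
        omega
      have hev' : evalAt D x P ∈ Submodule.span K (insert (e j)
          (e '' {i : Fin r | (i : ℕ) < r - (m + 1)})) := by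
        rw [← Set.image_insert_eq, ← hset]
        exact hev
      obtain ⟨u, w, hw, hx⟩ := Submodule.mem_span_insert.mp hev'
      have hfj : D.toFun (e j) - f j • e j ∈ F (r - (m + 1)) := hf j
      have hprod : ∀ R, (∏ i ∈ Finset.univ.filter fun i : Fin r => r - (m + 1) ≤ (i : ℕ), max R (v (f i))) =
          max R (v (f j)) * ∏ i ∈ Finset.univ.filter fun i : Fin r => r - m ≤ (i : ℕ), max R (v (f i)) := by
        intro R
        rw [← Finset.prod_insert (a := j) (f := fun i => max R (v (f i)))]
        · refine Finset.prod_congr ?_ fun _ _ => rfl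
          ext i
          simp only [Finset.mem_filter, Finset.mem_univ, true_and, Finset.mem_insert,
            Fin.ext_iff, j]
          omega
        · simp only [Finset.mem_filter, Finset.mem_univ, true_and, j]
          omega
      have hpos : ∀ R, E < R → 0 < ∏ i ∈ Finset.univ.filter fun i : Fin r => r - m ≤ (i : ℕ), max R (v (f i)) :=
        fun R hR => Finset.prod_pos fun i _ => lt_max_of_lt_left (hE0.trans_lt hR)
      -- Modulo the next step of the flag the current vector is `u e_j`, on which `D` acts by `f_j +
      -- u⁻¹ d u`. For `u = 0` the convention `0⁻¹ = 0` leaves the factor `T - f_j`, which is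
      -- harmless.
      refine ⟨mulLinear d (f j + u⁻¹ * d u) P, monic_mulLinear d _ hP, ?_, ?_, fun R hR => ?_⟩
      · rw [natDegree_mulLinear d _ hP, hdeg]
      · rw [evalAt_mulLinear]
        change evalAt D x P = _ at hx
        rw [hx, D.toFun_add, D.toFun_smul]
        have hu : u * (u⁻¹ * d u) = d u := by
          rcases eq_or_ne u 0 with rfl | hu
          · simp
          · field_simp
        have : u • D.toFun (e j) + d u • e j + D.toFun w - (f j + u⁻¹ * d u) • (u • e j + w) =
            u • (D.toFun (e j) - f j • e j) + D.toFun w - (f j + u⁻¹ * d u) • w := by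
          have h2 : ((f j + u⁻¹ * d u) * u) = u * f j + d u := by linear_combination hu
          rw [smul_add, smul_smul, h2, add_smul, smul_sub, smul_smul]
          abel
        rw [this]
        exact sub_mem (add_mem (Submodule.smul_mem _ _ hfj) (hF _ _ hw))
          (Submodule.smul_mem _ _ hw)
      -- The logarithmic derivative `u⁻¹ d u` has absolute value at most `E < R`, so it is invisible
      -- at radius `R`.
      · have hmax : max R (v (f j + u⁻¹ * d u)) = max R (v (f j)) := by
          have hδ : v (u⁻¹ * d u) ≤ E := by
            rcases eq_or_ne u 0 with rfl | hu
            · simpa using hE0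
            · rw [map_mul, map_inv₀, inv_mul_le_iff₀ (v.pos hu), mul_comm]
              exact hE u
          rcases le_or_gt (v (f j)) E with h | h
          · rw [max_eq_left (h.trans hR.le),
              max_eq_left ((hv _ _).trans ((max_le h hδ).trans hR.le))]
          · rw [hv.add_eq_max_of_ne (hδ.trans_lt h).ne', max_eq_left (hδ.trans h.le)]
        rw [hprod, ← hmax]
        exact (hnorm R hR).mulLinear d hv hE hE0 hR (hpos R hR) _
  obtain ⟨P, hP, hdeg, hev, hnorm⟩ := key r le_rfl
  refine ⟨P, hP, hdeg, ?_, ?_⟩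
  · simpa [F] using hev
  · simpa using hnorm

/-- If a monic operator of degree `m` annihilates a cyclic vector, the dimension is at
most `m`. -/
theorem finrank_le_of_evalAt_eq_zero {x : V} (hx : Function.Surjective (evalAt D x)) {P : K[X]}
    (hP : P.Monic) (hP0 : evalAt D x P = 0) : Module.finrank K V ≤ P.natDegree := by
  have hmulT : ∀ Q : K[X], Q.Monic → (TwistedPolynomial.mulT d Q).Monic ∧
      (TwistedPolynomial.mulT d Q).natDegree = Q.natDegree + 1 := fun Q hQ => by
    have h : mulLinear d 0 Q = TwistedPolynomial.mulT d Q := by simp [mulLinear]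
    exact ⟨h ▸ monic_mulLinear d 0 hQ, h ▸ natDegree_mulLinear d 0 hQ⟩
  -- Left multiplication by `T` gives monic annihilators in every degree from `P.natDegree` on; they
  -- replace Euclidean division below, by removing leading terms one at a time.
  have hmult : ∀ a : ℕ, ∃ Q : K[X], Q.Monic ∧ Q.natDegree = P.natDegree + a ∧
      evalAt D x Q = 0 := by
    intro a
    induction a with
    | zero => exact ⟨P, hP, rfl, hP0⟩
    | succ a ih =>
      obtain ⟨Q, hQ, hdeg, h0⟩ := ih
      refine ⟨TwistedPolynomial.mulT d Q, (hmulT Q hQ).1, ?_, ?_⟩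
      · rw [(hmulT Q hQ).2, hdeg, add_assoc]
      · rw [evalAt_mulT, h0, D.toFun_zero]
  have hred : ∀ N : ℕ, ∀ q : K[X], q.degree < N →
      ∃ q' ∈ Polynomial.degreeLT K P.natDegree, evalAt D x q' = evalAt D x q := by
    intro N
    induction N with
    | zero =>
      intro q hq
      refine ⟨q, ?_, rfl⟩
      rw [Polynomial.mem_degreeLT]
      exact hq.trans_le (by exact_mod_cast Nat.zero_le _)
    | succ N ih =>
      intro q hq
      rcases lt_or_ge N P.natDegree with hN | hN
      · refine ⟨q, ?_, rfl⟩
        rw [Polynomial.mem_degreeLT]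
        exact hq.trans_le (by exact_mod_cast hN)
      · obtain ⟨Q, hQ, hdeg, h0⟩ := hmult (N - P.natDegree)
        obtain ⟨q', hq', he⟩ := ih (q - q.coeff N • Q) (by
          rw [Polynomial.degree_lt_iff_coeff_zero]
          intro i hi
          rw [Polynomial.coeff_sub, Polynomial.coeff_smul, smul_eq_mul]
          rcases hi.eq_or_lt with rfl | hi
          · have : Q.coeff N = 1 := by
              rw [← hQ.coeff_natDegree, hdeg]
              congr 1
              omega
            rw [this, mul_one, sub_self]
          · rw [(Polynomial.degree_lt_iff_coeff_zero _ _).mp hq i (by exact_mod_cast hi),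
              Polynomial.coeff_eq_zero_of_natDegree_lt (p := Q) (by omega), mul_zero, sub_zero])
        refine ⟨q', hq', ?_⟩
        rw [he, map_sub, map_smul, h0, smul_zero, sub_zero]
  have hsurj : Function.Surjective
      ((evalAt D x).comp (Polynomial.degreeLT K P.natDegree).subtype) := by
    intro y
    obtain ⟨q, rfl⟩ := hx y
    obtain ⟨q', hq', he⟩ := hred (q.natDegree + 1) q
      (Polynomial.degree_le_natDegree.trans_lt (by exact_mod_cast Nat.lt_succ_self _))
    exact ⟨⟨q', hq'⟩, he⟩
  have e := Polynomial.degreeLTEquiv K P.natDegree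
  have : Module.Finite K (Polynomial.degreeLT K P.natDegree) := Module.Finite.equiv e.symm
  have h := LinearMap.finrank_le_finrank_of_surjective hsurj
  rwa [e.finrank_eq, Module.finrank_fin_fun] at h

/-- A monic operator of degree equal to the dimension that annihilates a cyclic vector is unique. -/
theorem eq_of_evalAt_eq_zero {x : V} (hx : Function.Surjective (evalAt D x)) {P Q : K[X]}
    (hP : P.Monic) (hQ : Q.Monic) (hP0 : evalAt D x P = 0) (hQ0 : evalAt D x Q = 0)
    (hPd : P.natDegree = Module.finrank K V) (hQd : Q.natDegree = Module.finrank K V) :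
    P = Q := by
  by_contra hne
  have h0 : P - Q ≠ 0 := sub_ne_zero.mpr hne
  have hlt : (P - Q).degree < P.degree := by
    refine Polynomial.degree_sub_lt_left ?_ hP.ne_zero (by rw [hP.leadingCoeff, hQ.leadingCoeff])
    rw [Polynomial.degree_eq_natDegree hP.ne_zero, Polynomial.degree_eq_natDegree hQ.ne_zero,
      hPd, hQd]
  -- Normalised to be monic, `P - Q` would be an annihilator of degree smaller than the dimension.
  have h := finrank_le_of_evalAt_eq_zero D hx (Polynomial.monic_mul_leadingCoeff_inv h0) (by
    rw [mul_comm, ← Polynomial.smul_eq_C_mul, map_smul, map_sub, hP0, hQ0, sub_zero, smul_zero])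
  have hd : ((P - Q) * Polynomial.C (P - Q).leadingCoeff⁻¹).natDegree = (P - Q).natDegree :=
    Polynomial.natDegree_mul_C (inv_ne_zero (Polynomial.leadingCoeff_ne_zero.mpr h0))
  rw [hd, ← hPd] at h
  exact absurd (Polynomial.natDegree_lt_natDegree h0 hlt) (not_lt.mpr h)

end Triangular

/-! ### The absolute value `exp (-ord_x)` on the ramified extension. -/

namespace RamifiedField

variable (k : Type*) [Field k] (N : ℕ+)

theorem ord_mul {f g : RamifiedField k N} (hf : f ≠ 0) (hg : g ≠ 0) :
    ord k N (f * g) = ord k N f + ord k N g := by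
  have hf' : toLaurent k N f ≠ 0 := by simpa using hf
  have hg' : toLaurent k N g ≠ 0 := by simpa using hg
  rw [ord, ord, ord, map_mul, HahnSeries.order_mul hf' hg', Int.cast_add, add_div]

theorem ord_le_ord_of_order_le {f g : RamifiedField k N}
    (h : (toLaurent k N f).order ≤ (toLaurent k N g).order) : ord k N f ≤ ord k N g :=
  div_le_div_of_nonneg_right (by exact_mod_cast h) (by positivity)

theorem min_ord_le_ord_add {f g : RamifiedField k N} (hfg : f + g ≠ 0) :
    min (ord k N f) (ord k N g) ≤ ord k N (f + g) := by
  have h := HahnSeries.min_order_le_order_add (x := toLaurent k N f) (y := toLaurent k N g)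
    (by rw [← map_add]; exact (map_ne_zero _).mpr hfg)
  rw [← map_add] at h
  rcases min_le_iff.mp h with h | h
  · exact min_le_iff.mpr (Or.inl (ord_le_ord_of_order_le k N h))
  · exact min_le_iff.mpr (Or.inr (ord_le_ord_of_order_le k N h))

/-- The absolute value `exp (-ord_x f)` of `k̄((x^{1/N}))`. -/
def abv : AbsoluteValue (RamifiedField k N) ℝ where
  toFun f := open Classical in if f = 0 then 0 else Real.exp (-(ord k N f : ℝ))
  map_mul' f g := by
    rcases eq_or_ne f 0 with rfl | hf
    · simp
    rcases eq_or_ne g 0 with rfl | hg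
    · simp
    rw [if_neg hf, if_neg hg, if_neg (mul_ne_zero hf hg), ord_mul k N hf hg, ← Real.exp_add]
    congr 1
    push_cast
    ring
  nonneg' f := by
    split
    · exact le_rfl
    · positivity
  eq_zero' f := by
    split
    · simpa
    · simp [*]
  add_le' f g := by
    rcases eq_or_ne (f + g) 0 with hfg | hfg
    · rw [if_pos hfg]
      split <;> split <;> positivity
    rcases eq_or_ne f 0 with rfl | hf
    · have hg : g ≠ 0 := by simpa using hfg
      rw [if_neg hfg, if_pos rfl, if_neg hg, zero_add, zero_add]
    rcases eq_or_ne g 0 with rfl | hg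
    · rw [if_neg hfg, if_pos rfl, if_neg hf, add_zero, add_zero]
    rw [if_neg hf, if_neg hg, if_neg hfg]
    rcases min_le_iff.mp (min_ord_le_ord_add k N hfg) with h | h
    · exact (Real.exp_le_exp.mpr (neg_le_neg (by exact_mod_cast h))).trans
        (le_add_of_nonneg_right (Real.exp_pos _).le)
    · exact (Real.exp_le_exp.mpr (neg_le_neg (by exact_mod_cast h))).trans
        (le_add_of_nonneg_left (Real.exp_pos _).le)

theorem abv_of_ne_zero {f : RamifiedField k N} (hf : f ≠ 0) :
    abv k N f = Real.exp (-(ord k N f : ℝ)) := if_neg hf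

theorem isNonarchimedean_abv : IsNonarchimedean (abv k N) := by
  intro f g
  rcases eq_or_ne (f + g) 0 with hfg | hfg
  · rw [hfg, map_zero]
    exact le_max_of_le_left ((abv k N).nonneg f)
  rcases eq_or_ne f 0 with rfl | hf
  · simp
  rcases eq_or_ne g 0 with rfl | hg
  · simp
  rw [abv_of_ne_zero k N hf, abv_of_ne_zero k N hg, abv_of_ne_zero k N hfg]
  rcases min_le_iff.mp (min_ord_le_ord_add k N hfg) with h | h
  · exact le_max_of_le_left (Real.exp_le_exp.mpr (neg_le_neg (by exact_mod_cast h)))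
  · exact le_max_of_le_right (Real.exp_le_exp.mpr (neg_le_neg (by exact_mod_cast h)))

theorem coeff_toLaurent_ddx (f : RamifiedField k N) (n : ℤ) :
    (toLaurent k N (ddx k N f)).coeff n =
      ((N : ℕ) : AlgebraicClosure k)⁻¹ * (((n + (N : ℕ) : ℤ) : AlgebraicClosure k) *
        (toLaurent k N f).coeff (n + ((N : ℕ) : ℤ))) := by
  change (HahnSeries.single (1 - ((N : ℕ) : ℤ)) ((N : ℕ) : AlgebraicClosure k)⁻¹ *
    LaurentSeries.derivative (AlgebraicClosure k) (toLaurent k N f)).coeff n = _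
  rw [show n = (n + (N : ℕ) - 1) + (1 - ((N : ℕ) : ℤ)) by ring, HahnSeries.coeff_single_mul_add]
  simp

/-- The coefficient of `d f / dx` at `tⁿ` is a multiple of that of `f` at `tⁿ⁺ᴺ`, so differentiation
lowers `ord_x` by at most `1`. This bounds the operator norm of `d/dx` by `e`. -/
theorem abv_ddx_le (f : RamifiedField k N) : abv k N (ddx k N f) ≤ Real.exp 1 * abv k N f := by
  rcases eq_or_ne (ddx k N f) 0 with h0 | h0
  · rw [h0, map_zero]
    exact mul_nonneg (Real.exp_pos _).le ((abv k N).nonneg f)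
  have hf : f ≠ 0 := by
    rintro rfl
    exact h0 (map_zero _)
  have h0' : toLaurent k N (ddx k N f) ≠ 0 := by simpa using h0
  have hN : (0 : ℚ) < ((N : ℕ) : ℚ) := by exact_mod_cast N.pos
  have hle : (toLaurent k N f).order ≤ (toLaurent k N (ddx k N f)).order + ((N : ℕ) : ℤ) := by
    apply HahnSeries.order_le_of_coeff_ne_zero
    intro hz
    apply HahnSeries.coeff_order_eq_zero.not.mpr h0'
    rw [coeff_toLaurent_ddx, hz, mul_zero, mul_zero]
  have hle' : ord k N f ≤ ord k N (ddx k N f) + 1 := by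
    rw [ord, ord, ← div_self hN.ne', ← add_div]
    exact div_le_div_of_nonneg_right (by exact_mod_cast hle) hN.le
  rw [abv_of_ne_zero k N h0, abv_of_ne_zero k N hf, ← Real.exp_add, Real.exp_le_exp]
  have : (ord k N f : ℝ) ≤ (ord k N (ddx k N f) : ℝ) + 1 := by exact_mod_cast hle'
  linarith

theorem coeff_toLaurent_algebraMap (g : LaurentSeries k) (i : ℤ) :
    (toLaurent k N (algebraMap (LaurentSeries k) (RamifiedField k N) g)).coeff
      (((N : ℕ) : ℤ) * i) = algebraMap k (AlgebraicClosure k) (g.coeff i) :=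
  HahnSeries.embDomain_coeff (a := i)

theorem ord_algebraMap {g : LaurentSeries k} (hg : g ≠ 0) :
    ord k N (algebraMap (LaurentSeries k) (RamifiedField k N) g) = g.order := by
  have hN : (0 : ℚ) < ((N : ℕ) : ℚ) := by exact_mod_cast N.pos
  have h : (toLaurent k N (algebraMap (LaurentSeries k) (RamifiedField k N) g)).order =
      ((N : ℕ) : ℤ) * g.order := by
    have h0 : toLaurent k N (algebraMap (LaurentSeries k) (RamifiedField k N) g) ≠ 0 := by
      simpa using hg
    apply le_antisymm
    · apply HahnSeries.order_le_of_coeff_ne_zero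
      rw [coeff_toLaurent_algebraMap]
      simpa using HahnSeries.coeff_order_eq_zero.not.mpr hg
    · rw [HahnSeries.le_order_iff_forall h0]
      intro j hj
      by_cases hd : ((N : ℕ) : ℤ) ∣ j
      · obtain ⟨i, rfl⟩ := hd
        rw [coeff_toLaurent_algebraMap, HahnSeries.coeff_eq_zero_of_lt_order, map_zero]
        exact lt_of_mul_lt_mul_left hj (by positivity)
      · refine HahnSeries.embDomain_of_notMem_range ?_
        rintro ⟨i, rfl⟩
        exact hd ⟨i, rfl⟩
  rw [ord, h]
  push_cast
  field_simp

theorem abv_algebraMap {g : LaurentSeries k} (hg : g ≠ 0) :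
    abv k N (algebraMap (LaurentSeries k) (RamifiedField k N) g) =
      Real.exp (-(g.order : ℝ)) := by
  rw [abv_of_ne_zero k N (by simpa using hg), ord_algebraMap k N hg]
  norm_cast

/-- Since `1 + max (0, -1 - ord f) = max (1, -ord f)`, the truncation in the definition of the slope
is absorbed by `r ≥ 1`. For `f = 0` the junk value `ord 0 = 0` still gives slope `0`. -/
theorem max_exp_abv {r : ℝ} (hr : 1 ≤ r) (f : RamifiedField k N) :
    max (Real.exp r) (abv k N f) = Real.exp (max r (1 + (rankOneSlope k N f : ℝ))) := by
  rw [rankOneSlope]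
  push_cast
  rcases eq_or_ne f 0 with rfl | hf
  · have h0 : ord k N 0 = 0 := by simp [ord]
    rw [map_zero, max_eq_left (Real.exp_pos r).le, h0]
    congr 1
    simp [hr]
  · rw [abv_of_ne_zero k N hf, ← Real.exp_monotone.map_max]
    congr 1
    rw [← max_add_add_left, ← max_assoc, add_zero, max_eq_left hr]
    congr 1
    ring

end RamifiedField

/-! ### The Gauss norms of `ℓ` in terms of its formal slopes. -/

section Cyclic

variable {k : Type*} [Field k] [CharZero k] (N : ℕ+) (ℓ : TwistedPolynomial (ddx k))

/-- The base change of the differential module `k((x)){T} / k((x)){T}ℓ` to `k̄((x^{1/N}))`. -/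
abbrev ramifiedOperator : DifferentialOperator (RamifiedField.ddx k N)
    (RamifiedField k N ⊗[LaurentSeries k] CyclicModule ℓ) :=
  (cyclicOperator ℓ).baseChange (RamifiedField.ddx k N) (RamifiedField.ddx_algebraMap k N)

/-- The cyclic vector `1 ⊗ 1`. -/
abbrev cyclicVector : RamifiedField k N ⊗[LaurentSeries k] CyclicModule ℓ :=
  1 ⊗ₜ Submodule.Quotient.mk 1

theorem ramifiedOperator_tmul (b : RamifiedField k N) (m : CyclicModule ℓ) :
    (ramifiedOperator N ℓ).toFun (b ⊗ₜ m) =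
      RamifiedField.ddx k N b ⊗ₜ m + b ⊗ₜ (TwistedPolynomial.T (ddx k) • m) := rfl

theorem iterate_ramifiedOperator (i : ℕ) :
    (ramifiedOperator N ℓ).toFun^[i] (cyclicVector N ℓ) =
      1 ⊗ₜ Submodule.Quotient.mk (TwistedPolynomial.T (ddx k) ^ i) := by
  induction i with
  | zero => rfl
  | succ i ih =>
    rw [Function.iterate_succ_apply', ih, ramifiedOperator_tmul, AddDerivation.apply_one,
      TensorProduct.zero_tmul, zero_add, ← Submodule.Quotient.mk_smul, smul_eq_mul, pow_succ']

theorem TwistedPolynomial.monomial_eq {R : Type*} [CommRing R] (d : AddDerivation R) (i : ℕ)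
    (a : R) : (TwistedPolynomial.toPoly d).symm (Polynomial.monomial i a) =
      a • TwistedPolynomial.T d ^ i := by
  have h : ∀ i : ℕ, TwistedPolynomial.T d ^ i =
      (TwistedPolynomial.toPoly d).symm (Polynomial.monomial i 1) := by
    intro i
    induction i with
    | zero => rfl
    | succ i ih =>
      rw [pow_succ', ih]
      change TwistedPolynomial.mulEnd d Polynomial.X (Polynomial.monomial i 1) = _
      have hX : TwistedPolynomial.mulEnd d Polynomial.X = TwistedPolynomial.mulT d := by
        have h := TwistedPolynomial.mulEnd_monomial d 1 1
        rwa [pow_one, (Module.toAddMonoidEnd R R[X]).map_one, one_mul] at h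
      rw [hX, TwistedPolynomial.mulT_monomial, d.apply_one, map_zero, add_zero]
      rfl
  rw [h, ← map_smul, Polynomial.smul_monomial, smul_eq_mul, mul_one]

/-- For `p = ℓ` the right-hand side vanishes, so `ℓ` annihilates the cyclic vector; letting `p` vary
shows that this vector generates. -/
theorem evalAt_map (p : (LaurentSeries k)[X]) :
    evalAt (ramifiedOperator N ℓ) (cyclicVector N ℓ)
        (p.map (algebraMap (LaurentSeries k) (RamifiedField k N))) =
      1 ⊗ₜ Submodule.Quotient.mk ((TwistedPolynomial.toPoly (ddx k)).symm p) := by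
  induction p using Polynomial.induction_on' with
  | add p q hp hq =>
    rw [Polynomial.map_add, map_add, hp, hq, map_add, Submodule.Quotient.mk_add,
      TensorProduct.tmul_add]
  | monomial i a =>
    rw [Polynomial.map_monomial, evalAt_monomial, iterate_ramifiedOperator,
      TwistedPolynomial.monomial_eq, Submodule.Quotient.mk_smul, TensorProduct.tmul_smul,
      algebraMap_smul]

theorem evalAt_cyclicVector_surjective :
    Function.Surjective (evalAt (ramifiedOperator N ℓ) (cyclicVector N ℓ)) := by
  rw [← LinearMap.range_eq_top, eq_top_iff]
  rintro z -
  induction z using TensorProduct.induction_on with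
  | zero => exact zero_mem _
  | add y z hy hz => exact add_mem hy hz
  | tmul b m =>
    obtain ⟨p, rfl⟩ := Submodule.Quotient.mk_surjective _ m
    have h : b ⊗ₜ[LaurentSeries k] (Submodule.Quotient.mk p : CyclicModule ℓ) =
        b • ((1 : RamifiedField k N) ⊗ₜ[LaurentSeries k] Submodule.Quotient.mk p) := by
      rw [TensorProduct.smul_tmul', smul_eq_mul, mul_one]
    rw [h]
    exact Submodule.smul_mem _ _ ⟨_, evalAt_map N ℓ (TwistedPolynomial.toPoly (ddx k) p)⟩

/-- The support function of the Newton polygon of `ℓ` with respect to `ord_x` is determined by the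
formal slopes. -/
theorem IsFormalSlopes.isGreatest {s : Multiset ℚ} (hs : IsFormalSlopes (cyclicOperator ℓ) s)
    (hmonic : ℓ.Monic) (hcard : s.card = ℓ.natDegree) {r : ℝ} (hr : 1 < r) :
    IsGreatest {y : ℝ | ∃ i : ℕ, ℓ.coeff i ≠ 0 ∧ y = r * i - (ℓ.coeff i).order}
      (s.map fun β : ℚ => max r (1 + (β : ℝ))).sum := by
  obtain ⟨N, n, e, f, hf, rfl⟩ := hs
  obtain ⟨P, hP, hdeg, hev, hnorm⟩ := exists_monic_evalAt_eq_zero (ramifiedOperator N ℓ)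
    (RamifiedField.isNonarchimedean_abv k N) (Real.exp_pos 1).le
    (RamifiedField.abv_ddx_le k N) e f hf (cyclicVector N ℓ)
  have hn : n = ℓ.natDegree := by simpa using hcard
  have hinj : Function.Injective (algebraMap (LaurentSeries k) (RamifiedField k N)) :=
    (algebraMap (LaurentSeries k) (RamifiedField k N)).injective
  have hfin : Module.finrank (RamifiedField k N)
      (RamifiedField k N ⊗[LaurentSeries k] CyclicModule ℓ) = n := by
    rw [Module.finrank_eq_card_basis e, Fintype.card_fin]
  -- `P` and the image of `ℓ` are monic annihilators of the same cyclic vector, of degree equal to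
  -- the dimension; `hcard` identifies this dimension with the degree of `ℓ`.
  have hℓ : P = (TwistedPolynomial.toPoly (ddx k) ℓ).map
      (algebraMap (LaurentSeries k) (RamifiedField k N)) := by
    refine eq_of_evalAt_eq_zero (ramifiedOperator N ℓ) (evalAt_cyclicVector_surjective N ℓ) hP
      (hmonic.map _) hev ?_ (hdeg.trans hfin.symm) ?_
    · rw [evalAt_map, LinearEquiv.symm_apply_apply, (Submodule.Quotient.mk_eq_zero _).mpr
        (Submodule.mem_span_singleton_self ℓ), TensorProduct.tmul_zero]
    · rw [Polynomial.natDegree_map_eq_of_injective hinj, hfin, hn]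
      rfl
  have h := hnorm (Real.exp r) (Real.exp_lt_exp.mpr hr)
  have hcoeff : ∀ i, ℓ.coeff i ≠ 0 → RamifiedField.abv k N (P.coeff i) * Real.exp r ^ i =
      Real.exp (r * i - (ℓ.coeff i).order) := by
    intro i hi
    rw [hℓ, Polynomial.coeff_map]
    change RamifiedField.abv k N (algebraMap _ _ (ℓ.coeff i)) * _ = _
    rw [RamifiedField.abv_algebraMap k N hi, ← Real.exp_nat_mul, ← Real.exp_add]
    congr 1
    ring
  have hprod : ∏ i, max (Real.exp r) (RamifiedField.abv k N (f i)) =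
      Real.exp (((Finset.univ.val.map fun i => rankOneSlope k N (f i)).map
        fun β : ℚ => max r (1 + (β : ℝ))).sum) := by
    rw [Multiset.map_map]
    change _ = Real.exp (∑ i, max r (1 + (rankOneSlope k N (f i) : ℝ)))
    rw [Real.exp_sum]
    exact Finset.prod_congr rfl fun i _ => RamifiedField.max_exp_abv k N hr.le (f i)
  rw [hprod] at h
  refine ⟨?_, ?_⟩
  · obtain ⟨i, hi⟩ := h.1
    change RamifiedField.abv k N (P.coeff i) * Real.exp r ^ i = _ at hi
    -- The Gauss norm is positive, so it is not attained at a zero coefficient.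
    have hi0 : ℓ.coeff i ≠ 0 := by
      intro h0
      have : P.coeff i = 0 := by
        rw [hℓ, Polynomial.coeff_map]
        change algebraMap _ _ (ℓ.coeff i) = _
        rw [h0, map_zero]
      rw [this, map_zero, zero_mul] at hi
      exact (Real.exp_pos _).ne hi
    rw [hcoeff i hi0, Real.exp_eq_exp] at hi
    exact ⟨i, hi0, hi.symm⟩
  · rintro _ ⟨i, hi0, rfl⟩
    rw [← Real.exp_le_exp, ← hcoeff i hi0]
    exact h.2 ⟨i, rfl⟩

end Cyclic

/-! ### Recovering slopes from the support function. -/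

section Counting

/-- If `r ↦ ∑ⱼ max (r, Bⱼ)` is the support function of the points `(i, oᵢ)` for `r > 1`, then the
values `Bⱼ` are the slopes of the edges of the polygon. -/
theorem eq_slope_of_isGreatest {n : ℕ} {B : Fin n → ℝ} (hB : Antitone B) (hB1 : ∀ j, 1 ≤ B j)
    {S : Finset ℕ} (hS : ∀ l ∈ S, l ≤ n) {o : ℕ → ℝ}
    (hgr : ∀ r : ℝ, 1 < r →
      IsGreatest {y : ℝ | ∃ i ∈ S, y = r * i - o i} (∑ j, max r (B j)))
    {s : ℝ} (hs : 1 ≤ s) {h i : ℕ} (hh : h ∈ S) (hi : i ∈ S)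
    (hsup : ∀ l ∈ S, s * l - o l ≤ s * i - o i) (hhi : s * h - o h = s * i - o i)
    {j : Fin n} (hj : n ≤ j + i) (hj' : j + h < n) : B j = s := by
  -- The support function is only given for `r > 1`, whereas `s = 1` is allowed; its value at `s` is
  -- bounded by letting `r` decrease to `s`.
  have hle : ∑ j, max s (B j) ≤ s * i - o i := by
    refine le_of_forall_pos_le_add fun ε hε => ?_
    have hr : s < s + ε / (n + 1) := lt_add_of_pos_right _ (by positivity)
    obtain ⟨l, hl, heq⟩ := (hgr _ (hs.trans_lt hr)).1
    have h1 : ∑ j, max s (B j) ≤ ∑ j, max (s + ε / (n + 1)) (B j) :=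
      Finset.sum_le_sum fun j _ => max_le_max hr.le le_rfl
    have h2 : ε / (n + 1) * l ≤ ε := by
      rw [div_mul_eq_mul_div, div_le_iff₀ (by positivity)]
      have : (l : ℝ) ≤ n := by exact_mod_cast hS l hl
      nlinarith
    have h3 := hsup l hl
    linarith
  apply le_antisymm
  -- If `B j > s`, then between `s` and `B j` only the terms after `j` can grow, at most `i - 1` of
  -- them, while the point `i` forces growth by at least `i (B j - s)`.
  · by_contra! hlt
    have h1 := (hgr (B j) (hs.trans_lt hlt)).2 ⟨i, hi, rfl⟩
    have h2 : ∑ j', max (B j) (B j') - ∑ j', max s (B j') ≤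
        ∑ j', if j' ∈ Finset.Ioi j then B j - s else 0 := by
      rw [← Finset.sum_sub_distrib]
      refine Finset.sum_le_sum fun j' _ => ?_
      split_ifs with hj'
      · rw [sub_le_iff_le_add]
        refine max_le ?_ ?_
        · linarith [le_max_left s (B j')]
        · linarith [le_max_right s (B j')]
      · have : B j ≤ B j' := hB (by simpa using hj')
        rw [max_eq_right this, max_eq_right (hlt.le.trans this), sub_self]
    rw [← Finset.sum_filter, Finset.filter_mem_eq_inter, Finset.univ_inter, Finset.sum_const,
      Fin.card_Ioi, nsmul_eq_mul] at h2
    have h3 : ((n - 1 - (j : ℕ) : ℕ) : ℝ) ≤ (i : ℝ) - 1 := by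
      rw [le_sub_iff_add_le]
      exact_mod_cast (by omega : n - 1 - (j : ℕ) + 1 ≤ i)
    nlinarith [mul_le_mul_of_nonneg_right h3 (sub_nonneg.mpr hlt.le)]
  -- If `B j < r < s`, then between `r` and `s` all terms from `j` on grow at full rate, at least `h
  -- + 1` of them, while the point `h` allows growth by at most `h (s - r)`.
  · by_contra! hlt
    obtain ⟨r, hr1, hr2⟩ := exists_between hlt
    have h1 := (hgr r ((hB1 j).trans_lt hr1)).2 ⟨h, hh, rfl⟩
    have h2 : (∑ j', if j' ∈ Finset.Ici j then s - r else 0) ≤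
        ∑ j', max s (B j') - ∑ j', max r (B j') := by
      rw [← Finset.sum_sub_distrib]
      refine Finset.sum_le_sum fun j' _ => ?_
      split_ifs with hj'
      · have : B j' ≤ B j := hB (by simpa using hj')
        rw [max_eq_left (this.trans hr1.le), max_eq_left (this.trans hlt.le)]
      · exact sub_nonneg.mpr (max_le_max hr2.le le_rfl)
    rw [← Finset.sum_filter, Finset.filter_mem_eq_inter, Finset.univ_inter, Finset.sum_const,
      Fin.card_Ici, nsmul_eq_mul] at h2
    have h3 : (h : ℝ) + 1 ≤ ((n - (j : ℕ) : ℕ) : ℝ) := by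
      exact_mod_cast (by omega : h + 1 ≤ n - (j : ℕ))
    nlinarith [mul_le_mul_of_nonneg_right h3 (sub_nonneg.mpr hr2.le)]

end Counting

/-! ### Lower boundaries of convex hulls and supporting lines. -/

section LowerHull

/-- The lower boundary of the convex hull of a set of points of the plane. -/
def lowerHull (A : Set (ℝ × ℝ)) (x : ℝ) : EReal :=
  ⨅ z ∈ {z : ℝ | (x, z) ∈ convexHull ℝ A}, (z : EReal)

variable {A : Set (ℝ × ℝ)}

theorem lowerHull_le {x z : ℝ} (h : (x, z) ∈ convexHull ℝ A) : lowerHull A x ≤ z :=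
  iInf₂_le z h

theorem convex_halfPlane (a b c : ℝ) : Convex ℝ {P : ℝ × ℝ | a * P.1 + b * P.2 ≤ c} := by
  intro P hP Q hQ s t hs ht hst
  change a * P.1 + b * P.2 ≤ c at hP
  change a * Q.1 + b * Q.2 ≤ c at hQ
  change a * (s * P.1 + t * Q.1) + b * (s * P.2 + t * Q.2) ≤ c
  calc _ = s * (a * P.1 + b * P.2) + t * (a * Q.1 + b * Q.2) := by ring
    _ ≤ s * c + t * c := add_le_add (mul_le_mul_of_nonneg_left hP hs)
      (mul_le_mul_of_nonneg_left hQ ht)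
    _ = c := by rw [← add_mul, hst, one_mul]

/-- The half-plane above a line is convex, so it contains the hull as soon as it contains the
points. -/
theorem le_lowerHull {a b : ℝ} (h : ∀ P ∈ A, a * P.1 + b ≤ P.2) (x : ℝ) :
    ((a * x + b : ℝ) : EReal) ≤ lowerHull A x := by
  refine le_iInf₂ fun z hz => ?_
  have := convexHull_min (t := {P : ℝ × ℝ | a * P.1 + (-1) * P.2 ≤ -b})
    (fun P hP => by
      change a * P.1 + (-1) * P.2 ≤ -b
      linarith [h P hP]) (convex_halfPlane _ _ _) hz
  change a * x + (-1) * z ≤ -b at this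
  exact_mod_cast (by linarith : a * x + b ≤ z)

theorem lowerHull_eq_top {x y : ℝ} (h : ∀ P ∈ A, P.1 ≤ y) (hy : y < x) :
    lowerHull A x = ⊤ := by
  refine iInf₂_eq_top.mpr fun z hz => ?_
  have := convexHull_min (t := {P : ℝ × ℝ | 1 * P.1 + 0 * P.2 ≤ y})
    (fun P hP => by
      change 1 * P.1 + 0 * P.2 ≤ y
      linarith [h P hP]) (convex_halfPlane _ _ _) hz
  change 1 * x + 0 * z ≤ y at this
  linarith

theorem lowerHull_eq {a b u w : ℝ} (h : ∀ P ∈ A, a * P.1 + b ≤ P.2)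
    (hu : (u, a * u + b) ∈ A) (hw : (w, a * w + b) ∈ A) {x : ℝ} (hux : u ≤ x) (hxw : x ≤ w) :
    lowerHull A x = ((a * x + b : ℝ) : EReal) := by
  refine le_antisymm (lowerHull_le ?_) (le_lowerHull h x)
  rcases hux.eq_or_lt with rfl | hux
  · exact subset_convexHull ℝ A hu
  have huw : 0 < w - u := by linarith
  have := (convex_convexHull ℝ A) (subset_convexHull ℝ A hu) (subset_convexHull ℝ A hw)
    (div_nonneg (sub_nonneg.mpr hxw) huw.le) (div_nonneg (sub_nonneg.mpr hux.le) huw.le)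
    (by field_simp; ring)
  convert this using 1
  ext
  · change x = (w - x) / (w - u) * u + (x - u) / (w - u) * w
    field_simp
    ring
  · change a * x + b = (w - x) / (w - u) * (a * u + b) + (x - u) / (w - u) * (a * w + b)
    field_simp
    ring

end LowerHull

/-! ### Vertices and edges of the lower hull of finitely many points. -/

section Polygon

/-- The points `(-i, yᵢ)` for `i ∈ S`. -/
def polygonPoints (S : Finset ℕ) (y : ℕ → ℝ) : Set (ℝ × ℝ) := {P | ∃ i ∈ S, P = (-(i : ℝ), y i)}

/-- The determinant measuring how far the point with index `i` lies below the line through the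
points with indices `h < j`, if `h < i < j`; it is antisymmetric in `h, i, j`. -/
def cross (y : ℕ → ℝ) (h i j : ℕ) : ℝ :=
  ((i : ℝ) - h) * y j + ((j : ℝ) - i) * y h - ((j : ℝ) - h) * y i

/-- The point with index `i` lies strictly below all chords. -/
def IsVertex (S : Finset ℕ) (y : ℕ → ℝ) (i : ℕ) : Prop :=
  i ∈ S ∧ ∀ h ∈ S, ∀ j ∈ S, h < i → i < j → 0 < cross y h i j

variable {S : Finset ℕ} {y : ℕ → ℝ}

theorem mem_polygonPoints {i : ℕ} (hi : i ∈ S) : (-(i : ℝ), y i) ∈ polygonPoints S y :=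
  ⟨i, hi, rfl⟩

/-- If all points lie above the line through the points with indices `h < i`, the lower hull is
given by this line in between. -/
theorem lowerHull_polygonPoints_eq {h i : ℕ} (hh : h ∈ S) (hi : i ∈ S) (hhi : h < i)
    (hsup : ∀ l ∈ S, 0 ≤ cross y h i l) {x : ℝ} (hx : -(i : ℝ) ≤ x) (hx' : x ≤ -(h : ℝ)) :
    lowerHull (polygonPoints S y) x =
      (((y h - y i) / ((i : ℝ) - h) * x + (y i + (y h - y i) / ((i : ℝ) - h) * i) : ℝ) :
        EReal) := by
  have hpos : (0 : ℝ) < (i : ℝ) - h := sub_pos.mpr (by exact_mod_cast hhi)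
  refine lowerHull_eq (u := -(i : ℝ)) (w := -(h : ℝ)) ?_ ?_ ?_ hx hx'
  · rintro _ ⟨l, hl, rfl⟩
    have := hsup l hl
    rw [cross] at this
    change (y h - y i) / ((i : ℝ) - h) * -(l : ℝ) + (y i + (y h - y i) / ((i : ℝ) - h) * i) ≤ y l
    rw [show (y h - y i) / ((i : ℝ) - h) * -(l : ℝ) + (y i + (y h - y i) / ((i : ℝ) - h) * i) =
      ((y h - y i) * (i - l) + y i * (i - h)) / ((i : ℝ) - h) by field_simp; ring,
      div_le_iff₀ hpos]
    linarith
  · convert mem_polygonPoints (y := y) hi using 2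
    ring
  · convert mem_polygonPoints (y := y) hh using 2
    field_simp
    ring

theorem lowerHull_polygonPoints_left {h i : ℕ} (hh : h ∈ S) (hi : i ∈ S) (hhi : h < i)
    (hsup : ∀ l ∈ S, 0 ≤ cross y h i l) : lowerHull (polygonPoints S y) (-(i : ℝ)) = y i := by
  rw [lowerHull_polygonPoints_eq hh hi hhi hsup le_rfl
    (neg_le_neg (by exact_mod_cast hhi.le))]
  congr 1
  ring

theorem lowerHull_polygonPoints_right {h i : ℕ} (hh : h ∈ S) (hi : i ∈ S) (hhi : h < i)
    (hsup : ∀ l ∈ S, 0 ≤ cross y h i l) : lowerHull (polygonPoints S y) (-(h : ℝ)) = y h := by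
  rw [lowerHull_polygonPoints_eq hh hi hhi hsup
    (neg_le_neg (by exact_mod_cast hhi.le)) le_rfl]
  have hpos : (0 : ℝ) < (i : ℝ) - h := sub_pos.mpr (by exact_mod_cast hhi)
  congr 1
  field_simp
  ring

theorem lowerHull_polygonPoints_eq_top {x : ℝ} (h : ∀ l ∈ S, -x < (l : ℝ)) :
    lowerHull (polygonPoints S y) x = ⊤ := by
  rcases S.eq_empty_or_nonempty with rfl | hS
  · exact lowerHull_eq_top (y := x - 1) (by rintro _ ⟨l, hl, rfl⟩; simp at hl) (by linarith)
  · obtain ⟨l₀, hl₀, hmin⟩ := S.exists_min_image id hS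
    refine lowerHull_eq_top (y := -(l₀ : ℝ)) ?_ (by linarith [h l₀ hl₀])
    rintro _ ⟨l, hl, rfl⟩
    exact neg_le_neg (by exact_mod_cast hmin l hl)

/-- Between two vertices without a vertex in between, the polygon is straight. -/
theorem cross_nonneg_of_isVertex {h i : ℕ} (hh : IsVertex S y h) (hi : IsVertex S y i)
    (hhi : h < i) (hno : ∀ l, h < l → l < i → ¬ IsVertex S y l) :
    ∀ l ∈ S, 0 ≤ cross y h i l := by
  have hpos : (0 : ℝ) < (i : ℝ) - h := sub_pos.mpr (by exact_mod_cast hhi)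
  by_contra! hneg
  obtain ⟨l₁, hl₁, hl₁neg⟩ := hneg
  -- A point lowest below the line through `h` and `i`, of largest index among such points, is a
  -- vertex. It lies strictly between `h` and `i`, as elsewhere it would contradict that these are
  -- vertices.
  obtain ⟨l₀, hl₀, hmin⟩ := S.exists_min_image (cross y h i) ⟨l₁, hl₁⟩
  obtain ⟨l, hl, hmax⟩ := (S.filter fun l => cross y h i l = cross y h i l₀).exists_max_image id
    ⟨l₀, by simp [hl₀]⟩
  rw [Finset.mem_filter] at hl
  have hlneg : cross y h i l < 0 := by
    rw [hl.2]
    exact (hmin l₁ hl₁).trans_lt hl₁neg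
  have hge : ∀ p ∈ S, cross y h i l ≤ cross y h i p := fun p hp => hl.2 ▸ hmin p hp
  have hgt : ∀ p ∈ S, l < p → cross y h i l < cross y h i p := fun p hp hlp =>
    lt_of_le_of_ne (hge p hp) fun heq => by
      have := hmax p (Finset.mem_filter.mpr ⟨hp, heq ▸ hl.2⟩)
      exact absurd this (not_le.mpr hlp)
  have hhl : h < l := by
    by_contra! hle
    rcases hle.eq_or_lt with rfl | hlt
    · have : cross y l i l = 0 := by rw [cross]; ring
      linarith
    · have h1 := hh.2 l hl.1 i hi.1 hlt hhi
      have h2 : cross y l h i = cross y h i l := by rw [cross, cross]; ring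
      linarith
  have hli : l < i := by
    by_contra! hle
    rcases hle.eq_or_lt with rfl | hlt
    · have : cross y h i i = 0 := by rw [cross]; ring
      linarith
    · have h1 := hi.2 h hh.1 l hl.1 hhi hlt
      linarith
  refine hno l hhl hli ⟨hl.1, fun h' hh' j' hj' hlt hlt' => ?_⟩
  -- As a function of `p`, `cross y h i p` is `(i - h) y p` plus an affine function, and affine
  -- functions do not contribute to a determinant of three points.
  have hid : ((i : ℝ) - h) * cross y h' l j' =
      ((l : ℝ) - h') * (cross y h i j' - cross y h i l) +
        ((j' : ℝ) - l) * (cross y h i h' - cross y h i l) := by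
    simp only [cross]
    ring
  have h1 : (0 : ℝ) < (l : ℝ) - h' := sub_pos.mpr (by exact_mod_cast hlt)
  have h2 : (0 : ℝ) < (j' : ℝ) - l := sub_pos.mpr (by exact_mod_cast hlt')
  have h3 := mul_pos h1 (sub_pos.mpr (hgt j' hj' hlt'))
  have h4 := mul_nonneg h2.le (sub_nonneg.mpr (hge h' hh'))
  refine pos_of_mul_pos_right (a := (i : ℝ) - h) ?_ hpos.le
  linarith

theorem coe_le_lowerHull_of_slope {i : ℕ} {a : ℝ}
    (h : ∀ l ∈ S, y i + a * ((i : ℝ) - l) ≤ y l) (x : ℝ) :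
    ((y i + a * (x + i) : ℝ) : EReal) ≤ lowerHull (polygonPoints S y) x := by
  have := le_lowerHull (A := polygonPoints S y) (a := a) (b := y i + a * i) (by
    rintro _ ⟨l, hl, rfl⟩
    change a * -(l : ℝ) + (y i + a * i) ≤ y l
    linarith [h l hl]) x
  convert this using 2
  ring

/-- The slope of the lower hull jumps exactly at the vertices. -/
theorem slope_lt_slope_iff_isVertex {n i : ℕ} (hn : n ∈ S) (hin : i < n) :
    lowerHull (polygonPoints S y) (-(i : ℝ)) - lowerHull (polygonPoints S y) (-(i : ℝ) - 1) <
      lowerHull (polygonPoints S y) (-(i : ℝ) + 1) - lowerHull (polygonPoints S y) (-(i : ℝ)) ↔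
    IsVertex S y i := by
  constructor
  · intro hlt
    by_contra hvert
    by_cases hex : ∃ h ∈ S, h < i
    · obtain ⟨h₀, hh₀, hh₀i⟩ := hex
      -- `V p` is the height over `-i` of the chord joining the points of index `p.1` and `p.2`. A
      -- lowest chord around a non-vertex spans a supporting line, so the hull is straight on
      -- `[-i-1, -i+1]` and the two slopes agree.
      let V : ℕ × ℕ → ℝ := fun p =>
        (((i : ℝ) - p.1) * y p.2 + ((p.2 : ℝ) - i) * y p.1) / ((p.2 : ℝ) - p.1)
      obtain ⟨⟨h, j⟩, hmem, hmin⟩ := ((S.filter (· < i)) ×ˢ (S.filter (i < ·))).exists_min_image V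
        ⟨(h₀, n), by simp [hh₀, hh₀i, hn, hin]⟩
      simp only [Finset.mem_product, Finset.mem_filter] at hmem hmin
      obtain ⟨⟨hh, hhi⟩, hj, hij⟩ := hmem
      have hhj : h < j := hhi.trans hij
      have hhi' : (0 : ℝ) < (i : ℝ) - h := sub_pos.mpr (by exact_mod_cast hhi)
      have hij' : (0 : ℝ) < (j : ℝ) - i := sub_pos.mpr (by exact_mod_cast hij)
      have hhj' : (0 : ℝ) < (j : ℝ) - h := sub_pos.mpr (by exact_mod_cast hhj)
      have hsup : ∀ l ∈ S, 0 ≤ cross y h j l := by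
        intro l hl
        rcases lt_trichotomy l i with hli | rfl | hil
        · have hli' : (0 : ℝ) < (i : ℝ) - l := sub_pos.mpr (by exact_mod_cast hli)
          have hlj' : (0 : ℝ) < (j : ℝ) - l := by linarith
          have := hmin (l, j) ⟨⟨hl, hli⟩, hj, hij⟩
          simp only [V] at this
          rw [div_le_div_iff₀ hhj' hlj'] at this
          refine nonneg_of_mul_nonneg_right (a := (j : ℝ) - i) ?_ hij'
          rw [cross]
          linarith
        · by_contra! hneg
          apply hvert
          refine ⟨hl, fun h' hh' j' hj' hlt hlt' => ?_⟩
          have := hmin (h', j') ⟨⟨hh', hlt⟩, hj', hlt'⟩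
          have hpos' : (0 : ℝ) < (j' : ℝ) - h' :=
            sub_pos.mpr (by exact_mod_cast hlt.trans hlt')
          simp only [V] at this
          rw [cross] at hneg ⊢
          have h1 : y l < (((l : ℝ) - h) * y j + ((j : ℝ) - l) * y h) / ((j : ℝ) - h) := by
            rw [lt_div_iff₀ hhj']
            linarith
          have h2 := h1.trans_le this
          rw [lt_div_iff₀ hpos'] at h2
          linarith
        · have hil' : (0 : ℝ) < (l : ℝ) - i := sub_pos.mpr (by exact_mod_cast hil)
          have hhl' : (0 : ℝ) < (l : ℝ) - h := by linarith
          have := hmin (h, l) ⟨⟨hh, hhi⟩, hl, hil⟩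
          simp only [V] at this
          rw [div_le_div_iff₀ hhj' hhl'] at this
          refine nonneg_of_mul_nonneg_right (a := (i : ℝ) - h) ?_ hhi'
          rw [cross]
          linarith
      have hhi1 : (h : ℝ) + 1 ≤ i := by exact_mod_cast hhi
      have hij1 : (i : ℝ) + 1 ≤ j := by exact_mod_cast hij
      rw [lowerHull_polygonPoints_eq hh hj hhj hsup (x := -(i : ℝ)) (by linarith) (by linarith),
        lowerHull_polygonPoints_eq hh hj hhj hsup (x := -(i : ℝ) - 1) (by linarith)
          (by linarith),
        lowerHull_polygonPoints_eq hh hj hhj hsup (x := -(i : ℝ) + 1) (by linarith)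
          (by linarith)] at hlt
      rw [← EReal.coe_sub, ← EReal.coe_sub, EReal.coe_lt_coe_iff] at hlt
      linarith
    · push Not at hex
      have hiS : i ∉ S := fun hi => hvert ⟨hi, fun h hh j _ hlt _ =>
        absurd hlt (not_lt.mpr (hex h hh))⟩
      have hlt' : ∀ l ∈ S, i + 1 ≤ l := fun l hl =>
        lt_of_le_of_ne (hex l hl) fun h => hiS (h ▸ hl)
      have h0 : lowerHull (polygonPoints S y) (-(i : ℝ)) = ⊤ :=
        lowerHull_polygonPoints_eq_top fun l hl => by
          rw [neg_neg]
          exact_mod_cast hlt' l hl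
      rw [h0] at hlt
      -- In `EReal` one has `x - ⊤ = ⊥`, so nothing is smaller than the right-hand side.
      simp at hlt
  · intro hv
    have hnz : ∀ {a b : ℕ}, a < b → (0 : ℝ) < (b : ℝ) - a := fun h =>
      sub_pos.mpr (by exact_mod_cast h)
    obtain ⟨j, hj, hjmax⟩ := (S.filter (i < ·)).exists_max_image
      (fun j => (y i - y j) / ((j : ℝ) - i)) ⟨n, by simp [hn, hin]⟩
    simp only [Finset.mem_filter] at hj hjmax
    obtain ⟨hj, hij⟩ := hj
    -- `a` is the largest chord slope to the left of `i`, and `a'` below the smallest one to the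
    -- right. The vertex condition means `a < a'`, and every slope in `[a, a']` supports the hull at
    -- `i`. Without points to the right, the hull is `⊤` there.
    set a := (y i - y j) / ((j : ℝ) - i) with ha
    have hleft : ∀ l ∈ S, i < l → ∀ b, a ≤ b → y i + b * ((i : ℝ) - l) ≤ y l := by
      intro l hl hil b hab
      have h1 := (hjmax l ⟨hl, hil⟩).trans hab
      rw [div_le_iff₀ (hnz hil)] at h1
      linarith
    have hself : lowerHull (polygonPoints S y) (-(i : ℝ)) ≤ y i :=
      lowerHull_le (subset_convexHull ℝ _ (mem_polygonPoints hv.1))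
    have hfin : ∀ b, (∀ l ∈ S, y i + b * ((i : ℝ) - l) ≤ y l) →
        lowerHull (polygonPoints S y) (-(i : ℝ)) = y i := fun b hb =>
      le_antisymm hself (by simpa using coe_le_lowerHull_of_slope hb (-(i : ℝ)))
    have hslope : ∀ b, (∀ l ∈ S, y i + b * ((i : ℝ) - l) ≤ y l) →
        lowerHull (polygonPoints S y) (-(i : ℝ)) -
          lowerHull (polygonPoints S y) (-(i : ℝ) - 1) ≤ (b : EReal) := fun b hb => by
      have h1 := coe_le_lowerHull_of_slope hb (-(i : ℝ) - 1)
      have h2 := EReal.sub_le_sub (hfin b hb).le h1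
      refine h2.trans (le_of_eq ?_)
      rw [← EReal.coe_sub]
      congr 1
      ring
    by_cases hex : ∃ h ∈ S, h < i
    · obtain ⟨h₀, hh₀, hh₀i⟩ := hex
      obtain ⟨h, hh, hhmin⟩ := (S.filter (· < i)).exists_min_image
        (fun h => (y h - y i) / ((i : ℝ) - h)) ⟨h₀, by simp [hh₀, hh₀i]⟩
      simp only [Finset.mem_filter] at hh hhmin
      obtain ⟨hh, hhi⟩ := hh
      set a' := (y h - y i) / ((i : ℝ) - h) with ha'
      have haa' : a < a' := by
        rw [ha, ha', div_lt_div_iff₀ (hnz hij) (hnz hhi)]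
        have := hv.2 h hh j hj hhi hij
        rw [cross] at this
        linarith
      have hright : ∀ l ∈ S, l < i → ∀ b, b ≤ a' → y i + b * ((i : ℝ) - l) ≤ y l := by
        intro l hl hil b hab
        have h1 := hab.trans (hhmin l ⟨hl, hil⟩)
        rw [le_div_iff₀ (hnz hil)] at h1
        linarith
      have hall : ∀ b, a ≤ b → b ≤ a' → ∀ l ∈ S, y i + b * ((i : ℝ) - l) ≤ y l := by
        intro b hb hb' l hl
        rcases lt_trichotomy l i with hli | rfl | hil
        · exact hright l hl hli b hb'
        · simp
        · exact hleft l hl hil b hb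
      have h1 := coe_le_lowerHull_of_slope (hall a' haa'.le le_rfl) (-(i : ℝ) + 1)
      have h2 := EReal.sub_le_sub h1 hself
      refine (hslope a (hall a le_rfl haa'.le)).trans_lt (lt_of_lt_of_le ?_ h2)
      rw [← EReal.coe_sub, EReal.coe_lt_coe_iff]
      linarith
    · push Not at hex
      have hall : ∀ l ∈ S, y i + a * ((i : ℝ) - l) ≤ y l := by
        intro l hl
        rcases (hex l hl).eq_or_lt with rfl | hil
        · simp
        · exact hleft l hl hil a le_rfl
      have htop : lowerHull (polygonPoints S y) (-(i : ℝ) + 1) = ⊤ :=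
        lowerHull_polygonPoints_eq_top fun l hl => by
          have : (i : ℝ) ≤ l := by exact_mod_cast hex l hl
          linarith
      refine (hslope a hall).trans_lt ?_
      rw [htop, hfin a hall, EReal.top_sub_coe]
      exact EReal.coe_lt_top a

end Polygon

/-! ### Existence of a small radius. -/

section SmallRadius

open Filter Topology

variable {k : Type*} [NormedField k]

theorem exists_bound_of_mem_analyticRing [IsUltrametricDist k] {γ : ℝ} (hγ : 0 < γ)
    {f : LaurentSeries k} (hf : f ∈ analyticRing k γ) :
    ∃ C : ℝ, ∀ i : ℤ, ‖f.coeff i‖ * γ ^ i ≤ C := by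
  obtain ⟨m, g, hg, rfl⟩ := hf
  rw [PowerSeries.isRestricted_iff'] at hg
  obtain ⟨C, hC⟩ := hg.bddAbove_range
  have hC0 : 0 ≤ C := le_trans (by positivity) (hC ⟨0, rfl⟩)
  refine ⟨C * γ ^ (-(m : ℤ)), fun i => ?_⟩
  rw [show i = (i + m) + -(m : ℤ) by ring, HahnSeries.coeff_single_mul_add, one_mul,
    zpow_add₀ hγ.ne', ← mul_assoc]
  refine mul_le_mul_of_nonneg_right ?_ (by positivity)
  rcases lt_or_ge (i + m) 0 with hneg | hpos
  · rw [PowerSeries.coeff_coe, if_pos hneg, norm_zero, zero_mul]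
    exact hC0
  · obtain ⟨j, hj⟩ := Int.eq_ofNat_of_zero_le hpos
    rw [hj, HahnSeries.ofPowerSeries_apply_coeff, zpow_natCast]
    exact hC ⟨j, rfl⟩

theorem eventually_gaussNorm_eq [IsUltrametricDist k] {γ : ℝ} (hγ : 0 < γ)
    {f : LaurentSeries k} (hf : f ∈ analyticRing k γ) (hf0 : f ≠ 0) :
    ∀ᶠ ρ in 𝓝[>] (0 : ℝ), gaussNorm ρ f = ‖f.leadingCoeff‖ * ρ ^ f.order := by
  obtain ⟨C, hC⟩ := exists_bound_of_mem_analyticRing hγ hf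
  have hb : 0 < ‖f.leadingCoeff‖ := norm_pos_iff.mpr (HahnSeries.leadingCoeff_ne_zero.mpr hf0)
  have hlead : f.coeff f.order = f.leadingCoeff := HahnSeries.leadingCoeff_eq.symm
  have hCpos : 0 < C := lt_of_lt_of_le (by rw [hlead]; positivity) (hC f.order)
  -- The second bound amounts to `C (ρ/γ) ≤ |b| γ ^ ord`. Each term beyond the lowest one gains at
  -- least one factor `ρ/γ`, which is enough to bring it below the lowest term.
  have hc : 0 < min γ (γ * (‖f.leadingCoeff‖ * γ ^ f.order / C)) := by positivity
  filter_upwards [Ioc_mem_nhdsGT hc] with ρ hρ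
  obtain ⟨hρ0, hρ⟩ := hρ
  have hρ1 : ρ / γ ≤ 1 := (div_le_one hγ).mpr (hρ.trans (min_le_left _ _))
  have hρ2 : C * (ρ / γ) ≤ ‖f.leadingCoeff‖ * γ ^ f.order := by
    have := (div_le_iff₀' hγ).mpr (hρ.trans (min_le_right _ _))
    rwa [le_div_iff₀' hCpos] at this
  have hle : ∀ i : ℤ, ‖f.coeff i‖ * ρ ^ i ≤ ‖f.leadingCoeff‖ * ρ ^ f.order := by
    intro i
    rcases lt_trichotomy i f.order with hi | rfl | hi
    · rw [HahnSeries.coeff_eq_zero_of_lt_order hi, norm_zero, zero_mul]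
      positivity
    · rw [hlead]
    · have hpow : (ρ / γ) ^ (i - f.order) ≤ ρ / γ := by
        obtain ⟨j, hj⟩ := Int.eq_ofNat_of_zero_le (sub_nonneg.mpr hi.le)
        rw [hj, zpow_natCast]
        exact pow_le_of_le_one (by positivity) hρ1 (by omega)
      calc ‖f.coeff i‖ * ρ ^ i = ‖f.coeff i‖ * γ ^ i * (ρ / γ) ^ i := by
            rw [div_zpow]
            field_simp
        _ ≤ C * (ρ / γ) ^ i := mul_le_mul_of_nonneg_right (hC i) (by positivity)
        _ = C * (ρ / γ) ^ (i - f.order) * (ρ / γ) ^ f.order := by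
            rw [mul_assoc, ← zpow_add₀ (by positivity), sub_add_cancel]
        _ ≤ C * (ρ / γ) * (ρ / γ) ^ f.order := by gcongr
        _ ≤ ‖f.leadingCoeff‖ * γ ^ f.order * (ρ / γ) ^ f.order := by gcongr
        _ = ‖f.leadingCoeff‖ * ρ ^ f.order := by
            rw [div_zpow]
            field_simp
  refine le_antisymm (ciSup_le hle) ?_
  have := le_ciSup (f := fun i : ℤ => ‖f.coeff i‖ * ρ ^ i)
    ⟨_, Set.forall_mem_range.mpr hle⟩ f.order
  rwa [hlead] at this

theorem eventually_abs_div_neg_log_lt (X : ℝ) {ε : ℝ} (hε : 0 < ε) :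
    ∀ᶠ ρ in 𝓝[>] (0 : ℝ), |X / (-Real.log ρ)| < ε := by
  have h : Tendsto (fun ρ => X / (-Real.log ρ)) (𝓝[>] 0) (𝓝 0) :=
    (tendsto_neg_atBot_atTop.comp Real.tendsto_log_nhdsGT_zero).const_div_atTop X
  have := h.abs
  rw [abs_zero] at this
  exact this.eventually (gt_mem_nhds hε)

/-- Finitely many conditions are imposed, each valid for all sufficiently small `ρ`: in (ii) and
(iii) the numerators do not depend on `ρ`, while `-log ρ` tends to infinity. -/
theorem exists_isSmallRadius [IsUltrametricDist k] {γ : ℝ} (hγ₀ : 0 < γ) (hγ₁ : γ < 1)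
    (ℓ : TwistedPolynomial (ddx k)) (hcoeff : ∀ i, ℓ.coeff i ∈ analyticRing k γ) :
    ∃ c : ℝ, IsSmallRadius γ ℓ c := by
  set n := ℓ.natDegree with hn
  have h1 : ∀ᶠ ρ in 𝓝[>] (0 : ℝ), ∀ i ∈ Finset.range (n + 1), ℓ.coeff i ≠ 0 →
      gaussNorm ρ (ℓ.coeff i) = ‖(ℓ.coeff i).leadingCoeff‖ * ρ ^ (ℓ.coeff i).order := by
    rw [eventually_all_finset]
    intro i _
    by_cases h0 : ℓ.coeff i = 0
    · exact Eventually.of_forall fun _ h => absurd h0 h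
    · exact (eventually_gaussNorm_eq hγ₀ (hcoeff i) h0).mono fun _ h _ => h
  have h2 : ∀ᶠ ρ in 𝓝[>] (0 : ℝ), ∀ h ∈ Finset.range (n + 1), ∀ i ∈ Finset.range (n + 1),
      ∀ j ∈ Finset.range (n + 1),
      |Real.log
        ((‖(ℓ.coeff i).leadingCoeff‖ / ‖(ℓ.coeff h).leadingCoeff‖) ^ (1 / ((i : ℝ) - (h : ℝ))) *
          (‖(ℓ.coeff h).leadingCoeff‖ / ‖(ℓ.coeff j).leadingCoeff‖) ^ (1 / ((j : ℝ) - (h : ℝ)))) /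
      (-Real.log ρ)| < 1 / ((n : ℝ) ^ 2 + 1) := by
    simp only [eventually_all_finset]
    intro h _ i _ j _
    exact eventually_abs_div_neg_log_lt _ (by positivity)
  have h3 : ∀ᶠ ρ in 𝓝[>] (0 : ℝ), ∀ i ∈ Finset.range (n + 1), ∀ j ∈ Finset.range (n + 1),
      |Real.log
        ((‖(ℓ.coeff j).leadingCoeff‖ / ‖(ℓ.coeff i).leadingCoeff‖) ^ (1 / ((j : ℝ) - (i : ℝ)))) /
      (-Real.log ρ)| < 1 / ((n : ℝ) + 1) := by
    simp only [eventually_all_finset]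
    intro i _ j _
    exact eventually_abs_div_neg_log_lt _ (by positivity)
  obtain ⟨c, hc0, hc⟩ := (mem_nhdsGT_iff_exists_Ioc_subset).mp
    ((h1.and (h2.and h3)).and (Ioc_mem_nhdsGT hγ₀))
  have hc0' : 0 < c := hc0
  have hmem := fun ρ (h0 : 0 < ρ) (h : ρ ≤ c) => hc (show ρ ∈ Set.Ioc 0 c from ⟨h0, h⟩)
  have hcγ : c ≤ γ := (hmem c hc0' le_rfl).2.2
  have hr : ∀ {i : ℕ}, i ≤ n → i ∈ Finset.range (n + 1) := fun h =>
    Finset.mem_range.mpr (Nat.lt_succ_of_le h)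
  refine ⟨c, hc0', hcγ, hcγ.trans_lt hγ₁, ?_, ?_, ?_⟩
  · intro ρ h0 h i hi
    exact (hmem ρ h0 h).1.1 i (hr hi)
  · intro ρ h0 h a i j hai hij hj _ _ _
    exact (hmem ρ h0 h).1.2.1 a (hr (by omega)) i (hr (by omega)) j (hr hj)
  · intro ρ h0 h i j hij hj _ _
    exact (hmem ρ h0 h).1.2.2 i (hr (by omega)) j (hr hj)

end SmallRadius

/-! ### The Newton polygon at small radii against the polygon of orders. -/

section NewtonPolygon

variable {k : Type*} [NormedField k]

open Classical in
/-- The indices of the nonzero coefficients of `ℓ`. -/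
def coeffSupport (ℓ : TwistedPolynomial (ddx k)) : Finset ℕ :=
  (Finset.range (ℓ.natDegree + 1)).filter fun i => ℓ.coeff i ≠ 0

theorem mem_coeffSupport {ℓ : TwistedPolynomial (ddx k)} {i : ℕ} :
    i ∈ coeffSupport ℓ ↔ i ≤ ℓ.natDegree ∧ ℓ.coeff i ≠ 0 := by
  simp [coeffSupport]

theorem natDegree_mem_coeffSupport {ℓ : TwistedPolynomial (ddx k)} (hℓ : ℓ.Monic) :
    ℓ.natDegree ∈ coeffSupport ℓ := by
  rw [mem_coeffSupport]
  refine ⟨le_rfl, ?_⟩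
  have : ℓ.coeff ℓ.natDegree = 1 := Polynomial.Monic.coeff_natDegree hℓ
  rw [this]
  exact one_ne_zero

/-- The valuation `v_ρ(aᵢ)` of the `i`-th coefficient. -/
def height (ρ : ℝ) (ℓ : TwistedPolynomial (ddx k)) (i : ℕ) : ℝ :=
  -Real.log (gaussNorm ρ (ℓ.coeff i))

theorem newtonPolygon_eq (ρ : ℝ) (ℓ : TwistedPolynomial (ddx k)) :
    newtonPolygon ρ ℓ = lowerHull (polygonPoints (coeffSupport ℓ) (height ρ ℓ)) := by
  have : newtonPoints ρ ℓ = polygonPoints (coeffSupport ℓ) (height ρ ℓ) := by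
    ext P
    constructor
    · rintro ⟨i, hi, h0, rfl⟩
      exact ⟨i, mem_coeffSupport.mpr ⟨hi, h0⟩, rfl⟩
    · rintro ⟨i, hi, rfl⟩
      exact ⟨i, (mem_coeffSupport.mp hi).1, (mem_coeffSupport.mp hi).2, rfl⟩
  funext x
  rw [← this]
  rfl

theorem newtonSlope_add_one (ρ : ℝ) (ℓ : TwistedPolynomial (ddx k)) (m : ℤ) :
    newtonSlope ρ ℓ m (m + 1) = newtonPolygon ρ ℓ ((m : ℝ) + 1) - newtonPolygon ρ ℓ m := by
  rw [newtonSlope]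
  have h : (((m + 1 : ℤ) : ℝ) - (m : ℝ) : ℝ) = 1 := by push_cast; ring
  rw [h, EReal.coe_one, div_one, Int.cast_add, Int.cast_one]

/-- The breaks in the interior of the polygon are its vertices. -/
theorem mem_newtonBreaks_iff {ρ : ℝ} {ℓ : TwistedPolynomial (ddx k)} (hℓ : ℓ.Monic) {i : ℕ}
    (hi0 : 0 < i) (hin : i < ℓ.natDegree) :
    -(i : ℤ) ∈ newtonBreaks ρ ℓ ↔ IsVertex (coeffSupport ℓ) (height ρ ℓ) i := by
  rw [← slope_lt_slope_iff_isVertex (natDegree_mem_coeffSupport hℓ) hin, ← newtonPolygon_eq]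
  have h1 : newtonSlope ρ ℓ (-(i : ℤ) - 1) (-(i : ℤ)) =
      newtonPolygon ρ ℓ (-(i : ℝ)) - newtonPolygon ρ ℓ (-(i : ℝ) - 1) := by
    have := newtonSlope_add_one ρ ℓ (-(i : ℤ) - 1)
    push_cast at this
    rwa [sub_add_cancel, sub_add_cancel] at this
  have h2 : newtonSlope ρ ℓ (-(i : ℤ)) (-(i : ℤ) + 1) =
      newtonPolygon ρ ℓ (-(i : ℝ) + 1) - newtonPolygon ρ ℓ (-(i : ℝ)) := by
    have := newtonSlope_add_one ρ ℓ (-(i : ℤ))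
    push_cast at this
    exact this
  rw [← h1, ← h2]
  constructor
  · rintro (h | h | h)
    · omega
    · omega
    · exact h.2.2
  · exact fun h => Or.inr (Or.inr ⟨by omega, by omega, h⟩)

theorem bounds_of_mem_newtonBreaks {ρ : ℝ} {ℓ : TwistedPolynomial (ddx k)} {m : ℤ}
    (hm : m ∈ newtonBreaks ρ ℓ) : -(ℓ.natDegree : ℤ) ≤ m ∧ m ≤ 0 := by
  rcases hm with rfl | rfl | h
  · constructor <;> omega
  · constructor <;> omega
  · exact ⟨h.1.le, h.2.1.le⟩

/-- The two ends are breaks by decree. The end `-n` is a vertex because `ℓ` is monic, but `0` is one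
only if `a₀ ≠ 0`; otherwise the polygon is infinite there. -/
theorem isVertex_of_mem_newtonBreaks {ρ : ℝ} {ℓ : TwistedPolynomial (ddx k)} (hℓ : ℓ.Monic)
    {i : ℕ} (hi : -(i : ℤ) ∈ newtonBreaks ρ ℓ) (h0 : i = 0 → 0 ∈ coeffSupport ℓ) :
    IsVertex (coeffSupport ℓ) (height ρ ℓ) i := by
  have hb := bounds_of_mem_newtonBreaks hi
  rcases Nat.eq_zero_or_pos i with rfl | hpos
  · exact ⟨h0 rfl, fun h _ j _ hlt _ => absurd hlt (Nat.not_lt_zero h)⟩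
  rcases (show i ≤ ℓ.natDegree by omega).eq_or_lt with rfl | hlt
  · exact ⟨natDegree_mem_coeffSupport hℓ, fun h _ j hj _ hlt =>
      absurd hlt (not_lt.mpr (mem_coeffSupport.mp hj).1)⟩
  · exact (mem_newtonBreaks_iff hℓ hpos hlt).mp hi

/-- The order at `x = 0` of the `i`-th coefficient, as a real number. -/
def orderReal (ℓ : TwistedPolynomial (ddx k)) (i : ℕ) : ℝ := ((ℓ.coeff i).order : ℝ)

/-- The number `log |bᵢ|`, where `bᵢ` is the lowest coefficient of the Laurent series `aᵢ`. -/
def logLead (ℓ : TwistedPolynomial (ddx k)) (i : ℕ) : ℝ :=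
  Real.log ‖(ℓ.coeff i).leadingCoeff‖

variable {γ c : ℝ} {ℓ : TwistedPolynomial (ddx k)}

theorem norm_leadingCoeff_pos {i : ℕ} (hi : i ∈ coeffSupport ℓ) :
    0 < ‖(ℓ.coeff i).leadingCoeff‖ :=
  norm_pos_iff.mpr (HahnSeries.leadingCoeff_ne_zero.mpr (mem_coeffSupport.mp hi).2)

namespace IsSmallRadius

theorem neg_log_pos (hc : IsSmallRadius γ ℓ c) {ρ : ℝ} (hρ : 0 < ρ) (hρc : ρ ≤ c) :
    0 < -Real.log ρ :=
  neg_pos.mpr (Real.log_neg hρ (hρc.trans_lt hc.lt_one))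

theorem height_eq (hc : IsSmallRadius γ ℓ c) {ρ : ℝ} (hρ : 0 < ρ) (hρc : ρ ≤ c) {i : ℕ}
    (hi : i ∈ coeffSupport ℓ) :
    height ρ ℓ i = -Real.log ρ * orderReal ℓ i - logLead ℓ i := by
  have hi' := mem_coeffSupport.mp hi
  rw [height, hc.gaussNorm_eq ρ hρ hρc i hi'.1 hi'.2,
    Real.log_mul (norm_leadingCoeff_pos hi).ne' (zpow_pos hρ _).ne', Real.log_zpow, orderReal,
    logLead]
  ring

theorem cross_height (hc : IsSmallRadius γ ℓ c) {ρ : ℝ} (hρ : 0 < ρ) (hρc : ρ ≤ c) {h i j : ℕ}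
    (hh : h ∈ coeffSupport ℓ) (hi : i ∈ coeffSupport ℓ) (hj : j ∈ coeffSupport ℓ) :
    cross (height ρ ℓ) h i j =
      -Real.log ρ * cross (orderReal ℓ) h i j - cross (logLead ℓ) h i j := by
  simp only [cross, hc.height_eq hρ hρc hh, hc.height_eq hρ hρc hi, hc.height_eq hρ hρc hj]
  ring

/-- The logarithm in condition (ii) equals `-cross (logLead ℓ) h i j / ((i - h) (j - h))`, and the
denominator is at most `n²`; this is where the constant `n² + 1` comes from. -/
theorem abs_cross_logLead_lt (hc : IsSmallRadius γ ℓ c) {ρ : ℝ} (hρ : 0 < ρ) (hρc : ρ ≤ c)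
    {h i j : ℕ} (hh : h ∈ coeffSupport ℓ) (hi : i ∈ coeffSupport ℓ) (hj : j ∈ coeffSupport ℓ)
    (hhi : h < i) (hij : i < j) : |cross (logLead ℓ) h i j| < -Real.log ρ := by
  have hL := hc.neg_log_pos hρ hρc
  have hjn := (mem_coeffSupport.mp hj).1
  have h1 : (0 : ℝ) < (i : ℝ) - h := sub_pos.mpr (by exact_mod_cast hhi)
  have h2 : (0 : ℝ) < (j : ℝ) - h := sub_pos.mpr (by exact_mod_cast hhi.trans hij)
  have bh := norm_leadingCoeff_pos hh
  have bi := norm_leadingCoeff_pos hi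
  have bj := norm_leadingCoeff_pos hj
  have ht := hc.triple ρ hρ hρc h i j hhi hij.le hjn (mem_coeffSupport.mp hh).2
    (mem_coeffSupport.mp hi).2 (mem_coeffSupport.mp hj).2
  rw [Real.log_mul (by positivity) (by positivity), Real.log_rpow (by positivity),
    Real.log_rpow (by positivity), Real.log_div bi.ne' bh.ne', Real.log_div bh.ne' bj.ne'] at ht
  change |(1 / ((i : ℝ) - h) * (logLead ℓ i - logLead ℓ h) +
    1 / ((j : ℝ) - h) * (logLead ℓ h - logLead ℓ j)) / -Real.log ρ| < _ at ht
  rw [show (1 / ((i : ℝ) - h) * (logLead ℓ i - logLead ℓ h) +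
      1 / ((j : ℝ) - h) * (logLead ℓ h - logLead ℓ j)) =
      -(cross (logLead ℓ) h i j / (((i : ℝ) - h) * ((j : ℝ) - h))) by
    rw [cross]
    field_simp
    ring, abs_div, abs_neg, abs_div, abs_of_pos (mul_pos h1 h2), abs_of_pos hL,
    div_lt_iff₀ hL, div_lt_iff₀ (mul_pos h1 h2)] at ht
  refine ht.trans_le ?_
  have hn1 : (i : ℝ) - h ≤ ℓ.natDegree := by
    have : (i : ℝ) ≤ ℓ.natDegree := by exact_mod_cast hij.le.trans hjn
    linarith [(Nat.cast_nonneg h : (0 : ℝ) ≤ h)]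
  have hn2 : (j : ℝ) - h ≤ ℓ.natDegree := by
    have : (j : ℝ) ≤ ℓ.natDegree := by exact_mod_cast hjn
    linarith [(Nat.cast_nonneg h : (0 : ℝ) ≤ h)]
  have hn3 : ((i : ℝ) - h) * ((j : ℝ) - h) ≤ (ℓ.natDegree : ℝ) ^ 2 + 1 := by
    have := mul_le_mul hn1 hn2 h2.le (h1.le.trans hn1)
    nlinarith
  calc _ = -Real.log ρ * ((((i : ℝ) - h) * ((j : ℝ) - h)) / ((ℓ.natDegree : ℝ) ^ 2 + 1)) := by
        ring
    _ ≤ -Real.log ρ * 1 :=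
        mul_le_mul_of_nonneg_left ((div_le_one (by positivity)).mpr hn3) hL.le
    _ = _ := mul_one _

end IsSmallRadius

theorem exists_int_cross_orderReal (ℓ : TwistedPolynomial (ddx k)) (h i j : ℕ) :
    ∃ z : ℤ, cross (orderReal ℓ) h i j = z :=
  ⟨((i : ℤ) - h) * (ℓ.coeff j).order + ((j : ℤ) - i) * (ℓ.coeff h).order -
    ((j : ℤ) - h) * (ℓ.coeff i).order, by
      rw [cross, orderReal, orderReal, orderReal]
      push_cast
      ring⟩

namespace IsSmallRadius

/-- The convexity type of a triple of points does not depend on the radius. -/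
theorem cross_height_pos_iff (hc : IsSmallRadius γ ℓ c) {ρ : ℝ} (hρ : 0 < ρ) (hρc : ρ ≤ c)
    {h i j : ℕ} (hh : h ∈ coeffSupport ℓ) (hi : i ∈ coeffSupport ℓ) (hj : j ∈ coeffSupport ℓ)
    (hhi : h < i) (hij : i < j) :
    0 < cross (height ρ ℓ) h i j ↔ 0 < cross (orderReal ℓ) h i j ∨
      (cross (orderReal ℓ) h i j = 0 ∧ cross (logLead ℓ) h i j < 0) := by
  have hL := hc.neg_log_pos hρ hρc
  have habs := abs_lt.mp (hc.abs_cross_logLead_lt hρ hρc hh hi hj hhi hij)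
  rw [hc.cross_height hρ hρc hh hi hj]
  obtain ⟨z, hz⟩ := exists_int_cross_orderReal ℓ h i j
  rw [hz]
  -- A nonzero integer `z` contributes at least `-log ρ` in absolute value, more than the
  -- logarithmic part can compensate.
  rcases lt_trichotomy z 0 with h0 | rfl | h0
  · have h1 : (z : ℝ) ≤ -1 := by exact_mod_cast (by omega : z ≤ -1)
    have h2 := mul_le_mul_of_nonneg_left h1 hL.le
    refine ⟨fun h => by linarith, ?_⟩
    rintro (h | ⟨h, -⟩) <;> linarith
  · simp
  · have h1 : (1 : ℝ) ≤ z := by exact_mod_cast (by omega : 1 ≤ z)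
    have h2 := mul_le_mul_of_nonneg_left h1 hL.le
    exact ⟨fun _ => Or.inl (by linarith), fun _ => by linarith⟩

theorem isVertex_iff (hc : IsSmallRadius γ ℓ c) {ρ : ℝ} (hρ : 0 < ρ) (hρc : ρ ≤ c) (i : ℕ) :
    IsVertex (coeffSupport ℓ) (height ρ ℓ) i ↔ IsVertex (coeffSupport ℓ) (height c ℓ) i := by
  refine and_congr_right fun hi => forall_congr' fun h => forall_congr' fun hh =>
    forall_congr' fun j => forall_congr' fun hj => forall_congr' fun hhi =>
    forall_congr' fun hij => ?_
  rw [hc.cross_height_pos_iff hρ hρc hh hi hj hhi hij,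
    hc.cross_height_pos_iff hc.pos le_rfl hh hi hj hhi hij]

theorem newtonBreaks_eq (hc : IsSmallRadius γ ℓ c) (hℓ : ℓ.Monic) {ρ : ℝ} (hρ : 0 < ρ)
    (hρc : ρ ≤ c) : newtonBreaks ρ ℓ = newtonBreaks c ℓ := by
  ext m
  by_cases hm : -(ℓ.natDegree : ℤ) < m ∧ m < 0
  · obtain ⟨i, rfl⟩ : ∃ i : ℕ, m = -(i : ℤ) := ⟨(-m).toNat, by omega⟩
    rw [mem_newtonBreaks_iff hℓ (by omega) (by omega),
      mem_newtonBreaks_iff hℓ (by omega) (by omega), hc.isVertex_iff hρ hρc]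
  · constructor
    · rintro (h | h | h)
      · exact Or.inl h
      · exact Or.inr (Or.inl h)
      · exact absurd ⟨h.1, h.2.1⟩ hm
    · rintro (h | h | h)
      · exact Or.inl h
      · exact Or.inr (Or.inl h)
      · exact absurd ⟨h.1, h.2.1⟩ hm

/-- A negative integer would contribute at most `log c`, which the logarithmic part cannot offset.
Thus a supporting line for the heights gives one for the orders, although it may meet more points
there. -/
theorem cross_orderReal_nonneg (hc : IsSmallRadius γ ℓ c) {h i l : ℕ}
    (hh : h ∈ coeffSupport ℓ) (hi : i ∈ coeffSupport ℓ) (hl : l ∈ coeffSupport ℓ) (hhi : h < i)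
    (hcr : 0 ≤ cross (height c ℓ) h i l) : 0 ≤ cross (orderReal ℓ) h i l := by
  have hL := hc.neg_log_pos hc.pos le_rfl
  have habs : |cross (logLead ℓ) h i l| < -Real.log c := by
    -- Up to sign the determinant depends only on the set of the three indices, and it vanishes if
    -- two coincide, so the bound for ordered triples suffices.
    rcases lt_trichotomy l h with hlh | rfl | hhl
    · rw [show cross (logLead ℓ) h i l = cross (logLead ℓ) l h i by simp only [cross]; ring]
      exact hc.abs_cross_logLead_lt hc.pos le_rfl hl hh hi hlh hhi
    · rw [show cross (logLead ℓ) l i l = 0 by simp only [cross]; ring, abs_zero]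
      exact hL
    rcases lt_trichotomy l i with hli | rfl | hil
    · rw [show cross (logLead ℓ) h i l = -cross (logLead ℓ) h l i by simp only [cross]; ring,
        abs_neg]
      exact hc.abs_cross_logLead_lt hc.pos le_rfl hh hl hi hhl hli
    · rw [show cross (logLead ℓ) h l l = 0 by simp only [cross]; ring, abs_zero]
      exact hL
    · exact hc.abs_cross_logLead_lt hc.pos le_rfl hh hi hl hhi hil
  rw [hc.cross_height hc.pos le_rfl hh hi hl] at hcr
  obtain ⟨z, hz⟩ := exists_int_cross_orderReal ℓ h i l
  rw [hz] at hcr ⊢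
  by_contra! hneg
  have hneg' : z < 0 := by exact_mod_cast hneg
  have h1 : (z : ℝ) ≤ -1 := by exact_mod_cast (by omega : z ≤ -1)
  have h2 := mul_le_mul_of_nonneg_left h1 hL.le
  linarith [(abs_lt.mp habs).1]

/-- The formal slope of an effective edge is at most `-1`. -/
theorem one_le_formal_slope (hc : IsSmallRadius γ ℓ c) {h i : ℕ} (hh : h ∈ coeffSupport ℓ)
    (hi : i ∈ coeffSupport ℓ) (hhi : h < i)
    (hlt : (height c ℓ h - height c ℓ i) / ((i : ℝ) - h) < Real.log c) :
    1 ≤ (orderReal ℓ i - orderReal ℓ h) / ((i : ℝ) - h) := by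
  have hL := hc.neg_log_pos hc.pos le_rfl
  have hin := (mem_coeffSupport.mp hi).1
  have h1 : (0 : ℝ) < (i : ℝ) - h := sub_pos.mpr (by exact_mod_cast hhi)
  have bh := norm_leadingCoeff_pos hh
  have bi := norm_leadingCoeff_pos hi
  have hp := hc.pair c hc.pos le_rfl h i hhi hin (mem_coeffSupport.mp hh).2
    (mem_coeffSupport.mp hi).2
  rw [Real.log_rpow (by positivity), Real.log_div bi.ne' bh.ne', abs_div, abs_of_pos hL,
    div_lt_iff₀ hL] at hp
  change |1 / ((i : ℝ) - h) * (logLead ℓ i - logLead ℓ h)| < _ at hp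
  rw [abs_mul, abs_of_pos (by positivity : 0 < 1 / ((i : ℝ) - h)), one_div_mul_eq_div,
    div_lt_iff₀ h1] at hp
  have hp' : |logLead ℓ i - logLead ℓ h| < -Real.log c := by
    refine hp.trans_le ?_
    have hn : (i : ℝ) - h ≤ ℓ.natDegree + 1 := by
      have : (i : ℝ) ≤ ℓ.natDegree := by exact_mod_cast hin
      linarith [(Nat.cast_nonneg h : (0 : ℝ) ≤ h)]
    calc _ = -Real.log c * (((i : ℝ) - h) / ((ℓ.natDegree : ℝ) + 1)) := by ring
      _ ≤ -Real.log c * 1 :=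
          mul_le_mul_of_nonneg_left ((div_le_one (by positivity)).mpr hn) hL.le
      _ = _ := mul_one _
  rw [div_lt_iff₀ h1, hc.height_eq hc.pos le_rfl hh, hc.height_eq hc.pos le_rfl hi] at hlt
  rw [le_div_iff₀ h1, one_mul]
  -- The claim is `z ≥ 0`. Effectiveness and `hp'` give `z > -1`, and `z` is an integer.
  obtain ⟨z, hz⟩ : ∃ z : ℤ, orderReal ℓ i - orderReal ℓ h - ((i : ℝ) - h) = z :=
    ⟨(ℓ.coeff i).order - (ℓ.coeff h).order - ((i : ℤ) - h), by
      rw [orderReal, orderReal]; push_cast; ring⟩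
  by_contra! hneg
  have hz0 : (z : ℝ) < 0 := by linarith
  have hz0' : z < 0 := by exact_mod_cast hz0
  have hz1 : (z : ℝ) ≤ -1 := by exact_mod_cast (by omega : z ≤ -1)
  have h2 := mul_le_mul_of_nonneg_left hz1 hL.le
  rw [← hz] at h2
  linarith [(abs_lt.mp hp').1]

end IsSmallRadius

end NewtonPolygon

/-! ### From edges of the Newton polygon to formal slopes. -/

section FormalSlopes

variable {k : Type*} [NormedField k] {γ c : ℝ} {ℓ : TwistedPolynomial (ddx k)}

theorem IsFormalSlopes.nonneg {k : Type*} [Field k] [CharZero k] {M : Type*} [AddCommGroup M]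
    [Module (LaurentSeries k) M] {D : DifferentialOperator (ddx k) M} {s : Multiset ℚ}
    (hs : IsFormalSlopes D s) : ∀ β ∈ s, 0 ≤ β := by
  obtain ⟨N, r, e, f, -, rfl⟩ := hs
  intro β hβ
  obtain ⟨i, -, rfl⟩ := Multiset.mem_map.mp hβ
  exact le_max_left _ _

/-- The slopes of two edges of a convex polygon are ordered. -/
theorem edge_slope_le {S : Finset ℕ} {y : ℕ → ℝ} {h i h' i' : ℕ} (hi : i ∈ S) (hh' : h' ∈ S)
    (hhi : h < i) (hhi' : h' < i') (hle : h' < i) (hsup : ∀ l ∈ S, 0 ≤ cross y h i l)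
    (hsup' : ∀ l ∈ S, 0 ≤ cross y h' i' l) :
    (y h - y i) / ((i : ℝ) - h) ≤ (y h' - y i') / ((i' : ℝ) - h') := by
  have h1 : (0 : ℝ) < (i : ℝ) - h := sub_pos.mpr (by exact_mod_cast hhi)
  have h2 : (0 : ℝ) < (i' : ℝ) - h' := sub_pos.mpr (by exact_mod_cast hhi')
  have h3 : (0 : ℝ) < (i : ℝ) - h' := sub_pos.mpr (by exact_mod_cast hle)
  -- Both edges are compared with the chord from the left end `i` of the first to the right end `h'`
  -- of the second.
  have e1 : (y h - y i) / ((i : ℝ) - h) ≤ (y h' - y i) / ((i : ℝ) - h') := by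
    rw [div_le_div_iff₀ h1 h3]
    have := hsup h' hh'
    rw [cross] at this
    linarith
  have e2 : (y h' - y i) / ((i : ℝ) - h') ≤ (y h' - y i') / ((i' : ℝ) - h') := by
    rw [div_le_div_iff₀ h3 h2]
    have := hsup' i hi
    rw [cross] at this
    linarith
  exact e1.trans e2

theorem newtonSlope_eq {ρ : ℝ} {h i : ℕ} (hh : h ∈ coeffSupport ℓ) (hi : i ∈ coeffSupport ℓ)
    (hhi : h < i) (hsup : ∀ l ∈ coeffSupport ℓ, 0 ≤ cross (height ρ ℓ) h i l) :
    newtonSlope ρ ℓ (-(i : ℤ)) (-(h : ℤ)) =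
      (((height ρ ℓ h - height ρ ℓ i) / ((i : ℝ) - h) : ℝ) : EReal) := by
  have h1 : newtonPolygon ρ ℓ ((-(i : ℤ) : ℤ) : ℝ) = (height ρ ℓ i : EReal) := by
    rw [newtonPolygon_eq, ← lowerHull_polygonPoints_left hh hi hhi hsup]
    push_cast
    rfl
  have h2 : newtonPolygon ρ ℓ ((-(h : ℤ) : ℤ) : ℝ) = (height ρ ℓ h : EReal) := by
    rw [newtonPolygon_eq, ← lowerHull_polygonPoints_right hh hi hhi hsup]
    push_cast
    rfl
  have h3 : ((-(h : ℤ) : ℤ) : ℝ) - ((-(i : ℤ) : ℤ) : ℝ) = (i : ℝ) - h := by push_cast; ring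
  rw [newtonSlope, h1, h2, h3, ← EReal.coe_sub, ← EReal.coe_div]

/-- An effective edge ends at a nonzero coefficient. -/
theorem zero_mem_coeffSupport_of_isEffective {ρ : ℝ} {i : ℕ} (hi : i ∈ coeffSupport ℓ)
    (hpos : 0 < i) (heff : IsEffective ρ ℓ (-(i : ℤ)) 0) : 0 ∈ coeffSupport ℓ := by
  by_contra h0
  have htop : newtonPolygon ρ ℓ ((0 : ℤ) : ℝ) = ⊤ := by
    rw [newtonPolygon_eq]
    refine lowerHull_polygonPoints_eq_top fun l hl => ?_
    have : 0 < l := Nat.pos_of_ne_zero fun h => h0 (h ▸ hl)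
    simpa using this
  have hne : newtonPolygon ρ ℓ ((-(i : ℤ) : ℤ) : ℝ) ≠ ⊤ := by
    rw [newtonPolygon_eq]
    refine ne_top_of_le_ne_top (EReal.coe_ne_top (height ρ ℓ i)) (lowerHull_le ?_)
    refine subset_convexHull ℝ _ ?_
    have := mem_polygonPoints (y := height ρ ℓ) hi
    push_cast
    exact this
  have hden : ((0 : ℤ) : ℝ) - ((-(i : ℤ) : ℤ) : ℝ) = i := by push_cast; ring
  have hi0 : (0 : EReal) < ((i : ℝ) : EReal) := by exact_mod_cast hpos
  rw [IsEffective, newtonSlope, htop, hden, EReal.top_sub hne,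
    EReal.top_div_of_pos_ne_top hi0 (EReal.coe_ne_top _)] at heff
  exact not_top_lt heff

/-- The formal slopes attached to an edge of the Newton polygon at a small radius. -/
theorem IsSmallRadius.formalSlope_eq [CharZero k] (hc : IsSmallRadius γ ℓ c) (hℓ : ℓ.Monic)
    {n : ℕ} (hn : ℓ.natDegree = n) {β : Fin n → ℚ} (hβ : Antitone β)
    (hs : IsFormalSlopes (cyclicOperator ℓ) (Finset.univ.val.map β)) {h i : ℕ}
    (hh : h ∈ coeffSupport ℓ) (hi : i ∈ coeffSupport ℓ) (hhi : h < i)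
    (hsup : ∀ l ∈ coeffSupport ℓ, 0 ≤ cross (height c ℓ) h i l)
    (hlt : (height c ℓ h - height c ℓ i) / ((i : ℝ) - h) < Real.log c)
    {j : Fin n} (hj : n ≤ j + i) (hj' : j + h < n) :
    β j = -1 - (((ℓ.coeff h).order : ℚ) - ((ℓ.coeff i).order : ℚ)) / ((i : ℚ) - h) := by
  have hpos : (0 : ℝ) < (i : ℝ) - h := sub_pos.mpr (by exact_mod_cast hhi)
  have key : 1 + (β j : ℝ) = (orderReal ℓ i - orderReal ℓ h) / ((i : ℝ) - h) := by
    refine eq_slope_of_isGreatest (B := fun j => 1 + (β j : ℝ)) (S := coeffSupport ℓ)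
      (o := orderReal ℓ) ?_ ?_ ?_ ?_ (hc.one_le_formal_slope hh hi hhi hlt) hh hi ?_ ?_ hj hj'
    · exact fun a b hab => add_le_add le_rfl (by exact_mod_cast hβ hab)
    · intro j
      have : 0 ≤ β j := hs.nonneg _ (Multiset.mem_map_of_mem _ (Finset.mem_univ_val j))
      have : (0 : ℝ) ≤ β j := by exact_mod_cast this
      linarith
    · exact fun l hl => hn ▸ (mem_coeffSupport.mp hl).1
    · intro r hr
      have := hs.isGreatest ℓ hℓ (by simp [hn]) hr
      rw [Multiset.map_map] at this
      change IsGreatest _ (∑ j, max r (1 + (β j : ℝ))) at this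
      convert this using 3 with y
      refine exists_congr fun l => and_congr_left fun _ => ?_
      rw [mem_coeffSupport, and_iff_right_iff_imp]
      exact fun h0 => Polynomial.le_natDegree_of_ne_zero h0
    · intro l hl
      have := hc.cross_orderReal_nonneg hh hi hl hhi (hsup l hl)
      rw [cross] at this
      rw [← sub_nonneg]
      have e : (orderReal ℓ i - orderReal ℓ h) / ((i : ℝ) - h) * i - orderReal ℓ i -
          ((orderReal ℓ i - orderReal ℓ h) / ((i : ℝ) - h) * l - orderReal ℓ l) =
          (((i : ℝ) - h) * orderReal ℓ l + ((l : ℝ) - i) * orderReal ℓ h -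
            ((l : ℝ) - h) * orderReal ℓ i) / ((i : ℝ) - h) := by
        field_simp
        ring
      rw [e]
      exact div_nonneg this hpos.le
    · field_simp
      ring
  have : (β j : ℝ) = ((-1 - (((ℓ.coeff h).order : ℚ) - ((ℓ.coeff i).order : ℚ)) /
      ((i : ℚ) - h) : ℚ) : ℝ) := by
    push_cast
    rw [orderReal, orderReal] at key
    rw [← neg_sub ((ℓ.coeff i).order : ℝ), neg_div]
    linarith
  exact_mod_cast this

end FormalSlopes

end DiffMod

end

/-! ### Assembly of the theorem. -/

theorem proposition5p6 {k : Type*} [NormedField k] [IsUltrametricDist k] [CharZero k]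
    {γ : ℝ} (hγ₀ : 0 < γ) (hγ₁ : γ < 1)
    (ℓ : TwistedPolynomial (ddx k)) (n : ℕ) (hn : 0 < n) (hdeg : ℓ.natDegree = n)
    (hmonic : ℓ.Monic) (hcoeff : ∀ i, ℓ.coeff i ∈ analyticRing k γ) :
    (∃ c : ℝ, IsSmallRadius γ ℓ c) ∧
    ∀ c : ℝ, IsSmallRadius γ ℓ c →
      (∀ ρ : ℝ, 0 < ρ → ρ ≤ c → newtonBreaks ρ ℓ = newtonBreaks c ℓ) ∧
      ∀ β : Fin n → ℚ, Antitone β →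
        IsFormalSlopes (cyclicOperator ℓ) (Finset.univ.val.map β) →
        ∀ (r : ℕ) (m : Fin (r + 1) → ℤ), StrictMono m → Set.range m = newtonBreaks c ℓ →
        ∀ t : Fin r, IsEffective c ℓ (m t.castSucc) (m t.succ) →
        ∀ s : Fin r, s ≤ t →
          ℓ.coeff (-(m s.castSucc)).toNat ≠ 0 ∧ ℓ.coeff (-(m s.succ)).toNat ≠ 0 ∧
          ∀ j : Fin n, m s.castSucc + n ≤ (j : ℕ) → ((j : ℕ) : ℤ) < m s.succ + n →
            β j = -1 - (((ℓ.coeff (-(m s.succ)).toNat).order : ℚ) -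
                ((ℓ.coeff (-(m s.castSucc)).toNat).order : ℚ)) /
              ((m s.succ : ℚ) - (m s.castSucc : ℚ)) := by
  refine ⟨exists_isSmallRadius hγ₀ hγ₁ ℓ hcoeff, fun c hc => ⟨fun ρ hρ hρc =>
    hc.newtonBreaks_eq hmonic hρ hρc, ?_⟩⟩
  intro β hβ hs r m hm hrange t heff s hst
  have hbreak : ∀ u, m u ∈ newtonBreaks c ℓ := fun u => hrange ▸ Set.mem_range_self u
  -- The coefficient index of a break; it decreases as the break moves right.
  let I : Fin (r + 1) → ℕ := fun u => (-(m u)).toNat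
  have hI : ∀ u, m u = -(I u : ℤ) := fun u => by
    have := (bounds_of_mem_newtonBreaks (hbreak u)).2
    simp only [I]
    omega
  have hIlt : ∀ u v, u < v → I v < I u := fun u v huv => by
    have := hm huv
    rw [hI, hI] at this
    omega
  have hvert : ∀ u, (I u = 0 → 0 ∈ coeffSupport ℓ) →
      IsVertex (coeffSupport ℓ) (height c ℓ) (I u) := fun u h0 =>
    isVertex_of_mem_newtonBreaks hmonic (hI u ▸ hbreak u) h0
  have hvertC : ∀ u : Fin r, IsVertex (coeffSupport ℓ) (height c ℓ) (I u.castSucc) := fun u =>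
    hvert _ fun h0 => by
      have := hIlt _ _ u.castSucc_lt_succ
      omega
  have hzero : I t.succ = 0 → 0 ∈ coeffSupport ℓ := fun h0 => by
    rw [hI, hI, h0] at heff
    have := hIlt _ _ t.castSucc_lt_succ
    exact zero_mem_coeffSupport_of_isEffective (hvertC t).1 (by omega) heff
  -- Only the right end of the edge `t` itself can have index `0`, and effectiveness of that edge
  -- then gives `a₀ ≠ 0`.
  have hvertS : ∀ u : Fin r, u ≤ t → IsVertex (coeffSupport ℓ) (height c ℓ) (I u.succ) :=
    fun u hu => hvert _ fun h0 => by
      rcases hu.eq_or_lt with rfl | hlt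
      · exact hzero h0
      · have := hIlt u.succ t.succ (Fin.succ_lt_succ_iff.mpr hlt)
        omega
  -- As `m` enumerates all breaks, no vertex lies strictly between consecutive ones.
  have hsup : ∀ u : Fin r, u ≤ t →
      ∀ l ∈ coeffSupport ℓ, 0 ≤ cross (height c ℓ) (I u.succ) (I u.castSucc) l := fun u hu =>
    cross_nonneg_of_isVertex (hvertS u hu) (hvertC u) (hIlt _ _ u.castSucc_lt_succ)
      fun l hl hl' hv => by
        have hb := (bounds_of_mem_newtonBreaks (hbreak u.castSucc)).1
        rw [hI] at hb
        have hmem := (mem_newtonBreaks_iff (ρ := c) hmonic (i := l) (by omega) (by omega)).mpr hv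
        rw [← hrange] at hmem
        obtain ⟨w, hw⟩ := hmem
        have h1 : u.castSucc < w := hm.lt_iff_lt.mp (by rw [hw, hI]; omega)
        have h2 : w < u.succ := hm.lt_iff_lt.mp (by rw [hw, hI]; omega)
        rw [Fin.lt_def] at h1 h2
        simp only [Fin.val_castSucc, Fin.val_succ] at h1 h2
        omega
  -- By convexity the edge `s ≤ t` is at most as steep as the effective edge `t`, hence effective
  -- too.
  have hslope : (height c ℓ (I s.succ) - height c ℓ (I s.castSucc)) /
      ((I s.castSucc : ℝ) - I s.succ) < Real.log c := by
    refine (edge_slope_le (hvertC s).1 (hvertS t le_rfl).1 (hIlt _ _ s.castSucc_lt_succ)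
      (hIlt _ _ t.castSucc_lt_succ) (hIlt _ _ ?_) (hsup s hst) (hsup t le_rfl)).trans_lt ?_
    · exact lt_of_le_of_lt (Fin.castSucc_le_castSucc_iff.mpr hst) t.castSucc_lt_succ
    · rw [IsEffective, hI, hI, newtonSlope_eq (hvertS t le_rfl).1 (hvertC t).1
        (hIlt _ _ t.castSucc_lt_succ) (hsup t le_rfl)] at heff
      exact_mod_cast heff
  refine ⟨(mem_coeffSupport.mp (hvertC s).1).2, (mem_coeffSupport.mp (hvertS s hst).1).2, ?_⟩
  intro j hj hj'
  have := hc.formalSlope_eq hmonic hdeg hβ hs (hvertS s hst).1 (hvertC s).1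
    (hIlt _ _ s.castSucc_lt_succ) (hsup s hst) hslope (j := j)
    (by rw [hI] at hj; omega) (by rw [hI] at hj'; omega)
  rw [this]
  congr 2
  rw [hI s.succ, hI s.castSucc]
  push_cast
  ring
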